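/- **Setting.** Let $d\ge 1$ and $K\ge 2$. A $K$-armed bandit machine with covariates is a sequence of independent random vectors $(X_t,Y_t^{(1)},\dots,Y_t^{(K)})$, $t\ge1$, where the $X_t$ are i.i.d. with law $P_X$ on $\mathcal X=[0,1]^d$, the rewards $Y^{(i)}_t$ lie in $[0,1]$, and $\mathbb E[Y_t^{(i)}\mid X_t]=f^{(i)}(X_t)$ with $f^{(i)}:\mathcal X\to[0,1]$. Put $f^\star(x)=\max_i f^{(i)}(x)$; let $f^\sharp(x)$ be the largest of the values $f^{(i)}(x)$ that are $<f^\star(x)$ if there is one, and $f^\sharp(x)=f^\star(x)$ otherwise. Assume that * $P_X$ has a Lebesgue density on $\mathcal X$ with values in $[\underline c,\bar c]$, where $0<\underline c\le\bar c<\infty$; * (smoothness) $|f^{(i)}(x)-f^{(i)}(x')|\le L\|x-x'\|^\beta$ for all $x,x'\in\mathcal X$ and all $i$; * (margin) $P_X[0<f^\star(X)-f^\sharp(X)\le\delta]\le C_0\delta^\alpha$ for all $\delta\in[0,\delta_0]$, where $\delta_0\in(0,1)$ and $C_0>0$. A policy $\pi=(\pi_t)$ chooses functions $\pi_t:\mathcal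 X\to\{1,\dots,K\}$ depending only on the covariates, pulled arms and received rewards before time $t$; at time $t$ arm $\pi_t(X_t)$ is pulled. Its regret is $R_n(\pi)=\sum_{t=1}^n E_X\big(f^\star(X)-f^{(\pi_t(X))}(X)\big)$, where $E_X$ is the expectation over a fresh $X\sim P_X$; this is a random variable, since $\pi_t$ depends on the past. **Policy.** Successive Elimination with parameters $T,\gamma$ for a static $K$-armed bandit works in rounds $\tau=1,2,\dots$. All arms are active at first, with averages $\bar Y^{(i)}=0$. At the start of round $\tau$ every active arm $i$ with $\bar Y^{(i)}<\max_{j\text{ active}}\bar Y^{(j)}-\gamma U(\tau,T)$ is eliminated, where $U(\tau,T)=2\sqrt{2\max(\log(T/\tau),1)/\tau}$; then each remaining arm is pulled once and $\bar Y^{(i)}$ becomes the average of its $\tau$ rewards. Binned Successive Elimination $\bar\pi$ with $M^d$ bins divides $[0,1]^d$ into the $M^d$ cubes of side $1/M$ of the regular grid and runs, separately in each cube, Successive Elimination with $T=nM^{-d}$ and $\gamma=1$ on the times at which the covariate falls in that cube. **Theorem.** Fix $d\ge1$, $\beta\in(0,1]$, $L>0$, $\alpha\in(0,1)$, $\underline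 c,\bar c>0$, $\delta_0\in(0,1)$ and $C_0>0$. There is a constant $C>0$, depending only on these parameters and in particular not on $K$ or $n$, such that for all $K\ge2$, all $n\ge K\log K$ and all machines as above, Binned Successive Elimination with $M=\big\lfloor\big(\tfrac{n}{K\log K}\big)^{1/(2\beta+d)}\big\rfloor$ satisfies $$\mathbb E\,R_n(\bar\pi)\le C\,n\Big(\frac{K\log K}{n}\Big)^{\beta(\alpha+1)/(2\beta+d)} .$$ -/

import Mathlib

open MeasureTheory ProbabilityTheory

noncomputable section

namespace CovBandit

/-- Points of `ℝ^d` with the Euclidean norm. -/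
abbrev Pt (d : ℕ) : Type := EuclideanSpace ℝ (Fin d)

/-- The covariate space `[0,1]^d`. -/
def cube (d : ℕ) : Set (Pt d) := {x | ∀ l, 0 ≤ x l ∧ x l ≤ 1}

section Values

variable {K : ℕ}

/-- `max_i v i` (used for `K ≥ 1`). -/
def topValue (v : Fin K → ℝ) : ℝ := ⨆ i, v i

/-- The second largest of the distinct values of `v`: the maximum of the values `v i` with
`v i < max v`, or `max v` itself if `v` is constant. -/
def secondValue (v : Fin K → ℝ) : ℝ :=
  if h : (Finset.univ.filter (fun i => v i < topValue v)).Nonempty then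
    (Finset.univ.filter (fun i => v i < topValue v)).sup' h v
  else topValue v

end Values

/-! ### The machine -/

/-- A `K`-armed bandit machine with covariates in `[0,1]^d`.  At time `t` the covariate is `X t` and
the reward of arm `i` is `Y t i`.  The vectors `(X t, Y t 1, …, Y t K)` are independent, the `X t`
have the common law `PX`, rewards lie in `[0,1]` and `E[Y t i | X t] = f i (X t)`. -/
structure IsMachine {d K : ℕ} {Ω : Type*} [MeasurableSpace Ω] (P : Measure Ω)
    (X : ℕ → Ω → Pt d) (Y : ℕ → Fin K → Ω → ℝ) (PX : Measure (Pt d))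
    (f : Fin K → Pt d → ℝ) : Prop where
  isProb : IsProbabilityMeasure P
  measurable_X : ∀ t, Measurable (X t)
  measurable_Y : ∀ t i, Measurable (Y t i)
  indep : iIndepFun (fun (t : ℕ) (ω : Ω) => ((X t ω, fun i => Y t i ω) : Pt d × (Fin K → ℝ))) P
  law_X : ∀ t, P.map (X t) = PX
  reward_mem : ∀ t i, ∀ᵐ ω ∂P, 0 ≤ Y t i ω ∧ Y t i ω ≤ 1
  mean_mem : ∀ i, ∀ x ∈ cube d, 0 ≤ f i x ∧ f i x ≤ 1
  condMean : ∀ t i,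
    P[Y t i | MeasurableSpace.comap (X t) inferInstance] =ᵐ[P] fun ω => f i (X t ω)

/-- `PX` lives on `[0,1]^d` and has there a Lebesgue density with values in `[cl, cu]`. -/
def DensityCondition {d : ℕ} (PX : Measure (Pt d)) (cl cu : ℝ) : Prop :=
  ∃ p : Pt d → ℝ, Measurable p ∧ (∀ x ∈ cube d, cl ≤ p x ∧ p x ≤ cu) ∧
    PX = (volume.restrict (cube d)).withDensity (fun x => ENNReal.ofReal (p x))

/-- Every mean reward function is `(β, L)`-Hölder on `[0,1]^d`. -/
def SmoothnessCondition {d K : ℕ} (f : Fin K → Pt d → ℝ) (β L : ℝ) : Prop :=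
  ∀ i, ∀ x ∈ cube d, ∀ x' ∈ cube d, |f i x - f i x'| ≤ L * ‖x - x'‖ ^ β

/-- The margin condition with parameter `α` and constants `δ₀, C₀`. -/
def MarginCondition {d K : ℕ} (PX : Measure (Pt d)) (f : Fin K → Pt d → ℝ) (α δ₀ C₀ : ℝ) : Prop :=
  ∀ δ : ℝ, 0 ≤ δ → δ ≤ δ₀ →
    PX.real {x | 0 < topValue (fun i => f i x) - secondValue (fun i => f i x) ∧
      topValue (fun i => f i x) - secondValue (fun i => f i x) ≤ δ} ≤ C₀ * δ ^ α

/-! ### Policies, the game and the regret -/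

/-- A list of past observations (covariate, pulled arm, reward), the most recent one first. -/
abbrev History (d K : ℕ) : Type := List (Pt d × Fin K × ℝ)

/-- A policy maps the observations strictly before the current time to a function from the
covariate space to the arms. -/
abbrev Policy (d K : ℕ) : Type := History d K → Pt d → Fin K

section Game

variable {d K : ℕ} {Ω : Type*}

/-- The observations made during the first `t` steps `0, …, t-1` of the game played with `π`. -/
def history (π : Policy d K) (X : ℕ → Ω → Pt d) (Y : ℕ → Fin K → Ω → ℝ) :
    ℕ → Ω → History d K
  | 0, _ => []
  | t + 1, ω =>
      (X t ω, π (history π X Y t ω) (X t ω), Y t (π (history π X Y t ω) (X t ω)) ω)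
        :: history π X Y t ω

/-- The cumulative regret `R_n(π) = ∑_t E_X (f⋆(X) - f^{(π_t(X))}(X))` after `n` steps: a random
variable, because the functions `π_t` depend on the past observations. -/
def regret (π : Policy d K) (X : ℕ → Ω → Pt d) (Y : ℕ → Fin K → Ω → ℝ) (PX : Measure (Pt d))
    (f : Fin K → Pt d → ℝ) (n : ℕ) (ω : Ω) : ℝ :=
  ∑ t ∈ Finset.range n,
    ∫ x, (topValue (fun i => f i x) - f (π (history π X Y t ω) x) x) ∂PX

end Game

/-! ### Successive Elimination (static) -/

/-- `U(τ,T) = 2 √(2 max(log(T/τ), 1) / τ)`. -/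
def confRadius (τ : ℕ) (T : ℝ) : ℝ :=
  2 * √(2 * max (Real.log (T / τ)) 1 / τ)

/-- The memory of the Successive Elimination policy inside a round: the number of the current round,
the arms still active, those of them that remain to be pulled in this round (the next one to be
pulled first), and the current average reward of each arm. -/
structure SEState (K : ℕ) where
  round : ℕ
  active : Finset (Fin K)
  queue : List (Fin K)
  mean : Fin K → ℝ

section SE

variable {K : ℕ}

/-- The arms `i ∈ S` with `m i ≥ max_{j ∈ S} m j - γ U(τ,T)`. -/
def survivors (γ T : ℝ) (τ : ℕ) (S : Finset (Fin K)) (m : Fin K → ℝ) : Finset (Fin K) :=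
  S.filter (fun i => ∀ j ∈ S, m j - γ * confRadius τ T ≤ m i)

/-- Begin round `τ` with the arms in `S`.  The test of an arm only uses the largest average at the
beginning of the round and the arm's own average, which does not change before the arm is pulled;
so all tests of the round can be made here.  The surviving arms are pulled once each, in increasing
order. -/
def startRound (γ T : ℝ) (τ : ℕ) (S : Finset (Fin K)) (m : Fin K → ℝ) : SEState K where
  round := τ
  active := survivors γ T τ S m
  queue := (survivors γ T τ S m).sort (· ≤ ·)
  mean := m

/-- The next arm to be pulled.  (An arm with the largest average always survives, so the queue is
never empty and the default value is never used.) -/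
def SEState.arm [NeZero K] (s : SEState K) : Fin K := s.queue.headD 0

/-- Process the reward `y` of the arm just pulled; begin a new round if this one is complete. -/
def SEState.record [NeZero K] (γ T : ℝ) (s : SEState K) (y : ℝ) : SEState K :=
  let m : Fin K → ℝ :=
    Function.update s.mean s.arm ((((s.round : ℝ) - 1) * s.mean s.arm + y) / (s.round : ℝ))
  match s.queue.tail with
  | [] => startRound γ T (s.round + 1) s.active m
  | i :: q => { round := s.round, active := s.active, queue := i :: q, mean := m }

/-- The state of the policy with parameters `T, γ` after the given rewards (most recent first). -/
def seState [NeZero K] (γ T : ℝ) : List ℝ → SEState K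
  | [] => startRound γ T 1 Finset.univ (fun _ => 0)
  | y :: ys => (seState γ T ys).record γ T y

/-- The Successive Elimination policy with parameters `T, γ`: the arm that is pulled next, given the
rewards received so far (most recent first). -/
def sePolicy [NeZero K] (γ T : ℝ) (ys : List ℝ) : Fin K := (seState γ T ys).arm

end SE

/-! ### Binned Successive Elimination -/

section BSE

variable {d K : ℕ}

/-- The (0-based) index of the bin of the regular partition of `[0,1]^d` into `M^d` cubes of side
`1/M` that contains `x`; common faces, which are null sets, are attributed to the upper bin. -/
def binIndex (M : ℕ) (x : Pt d) : Fin d → ℕ := fun l => min ⌊(M : ℝ) * x l⌋₊ (M - 1)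

theorem binIndex_spec {M : ℕ} (hM : 0 < M) {x : Pt d} (hx : x ∈ cube d) (l : Fin d) :
    binIndex M x l < M ∧ (binIndex M x l : ℝ) / M ≤ x l ∧
      x l ≤ ((binIndex M x l : ℝ) + 1) / M := by
  have hM' : (0 : ℝ) < M := by exact_mod_cast hM
  have h0 : (0 : ℝ) ≤ M * x l := mul_nonneg hM'.le (hx l).1
  refine ⟨?_, ?_, ?_⟩
  · unfold binIndex; omega
  · rw [div_le_iff₀ hM', mul_comm]
    refine le_trans ?_ (Nat.floor_le h0)
    exact_mod_cast min_le_left _ _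
  · rw [le_div_iff₀ hM', mul_comm]
    unfold binIndex
    rcases le_total ⌊(M : ℝ) * x l⌋₊ (M - 1) with h | h
    · rw [min_eq_left h]; exact (Nat.lt_floor_add_one _).le
    · rw [min_eq_right h]
      have h1 : ((M - 1 : ℕ) : ℝ) + 1 = M := by
        rw [Nat.cast_sub hM]; simp
      rw [h1]
      nlinarith [(hx l).2]

/-- Binned Successive Elimination with `M^d` bins: in each bin a separate Successive Elimination
policy with parameters `T, γ` is run, which is fed only with the rewards obtained when the covariate
fell in this bin. -/
def binnedSE [NeZero K] (M : ℕ) (γ T : ℝ) : Policy d K := fun h x =>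
  sePolicy γ T ((h.filter (fun o => binIndex M o.1 = binIndex M x)).map (fun o => o.2.2))

/-- The number `M = ⌊(n / (K log K))^{1/(2β+d)}⌋`. -/
def binCount (d K n : ℕ) (β : ℝ) : ℕ :=
  ⌊((n : ℝ) / ((K : ℝ) * Real.log K)) ^ (1 / (2 * β + d))⌋₊

/-- The policy for horizon `n`: `M` as above, `T = n M^{-d}` and `γ = 1`. -/
def bse [NeZero K] (n : ℕ) (β : ℝ) : Policy d K :=
  binnedSE (binCount d K n β) 1 ((n : ℝ) / (binCount d K n β : ℝ) ^ d)

end BSE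

end CovBandit

end

noncomputable section

namespace CovBandit

/-! ### Elementary properties of the confidence radius -/

section Radius

/-! Given that the covariate falls in a fixed bin, the rewards of arm `i` lie in `[0,1]` and have as
mean `μ i`, the average of `f i` over the bin. So each bin hosts a static problem with gaps `Δ i =
max μ - μ i`. At every point of the bin in the cube, `f⋆ - f i` differs from `Δ i` by at most `2ε`,
where `ε`, the oscillation, is of order `M^{-β}`.

One bin. Say that level `m` fails if the average of some arm after `m` pulls is more than `U(m+1)/2`
away from its mean. While no level below `r` has failed, the best arm is active and all arms active
in round `r` have gap at most `2U(r)` (`active_gap_aux`). Hence the gap of the pulled arm is at most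
`2U(r)` with `r` the current round, or `2U(m)` with `m` the first failed level (`gap_arm_le`). Group
rounds and levels in blocks `[2^k, 2^{k+1})`. At most `K 2^k` visits to the bin belong to a block of
rounds. A block of levels fails with probability at most `4K 2^k/T`, by a maximal inequality for one
exponential supermartingale per arm and sign (`measure_levelFails_le`), and the bin has at most `cu
T` expected visits. So both cases cost a multiple of `K 2^k U(2^k)`: the union bound over arms costs
no more than the pulls themselves.

All bins. Regret at most `4ε` at a point is either zero or confined to the margin region at level
`4ε`, which gives a term of order `n ε^{1+α}`. Larger regret forces `Δ i > 2ε`. If some arm of a bin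
has `2ε < Δ i ≤ 2U`, the whole bin lies, up to a null set, in the margin region at level `4U`, so
there are only `O(M^d U^α)` such bins (`card_bins_le`). What remains is `K M^d ∑ 2^k U(2^k)^{1+α}`
over the `k` with `U(2^k) > ε` (`integral_regret_le`).

The sum. As `U(2^k)^2` is `2^{-k}` up to a logarithm and `α < 1`, the sum is geometric and dominated
by its last terms, where `U(2^k)` is about `ε` (`sum_confRadius_le`). There the logarithm is of
order `log (n / M^{2β+d})`, and the choice of `M` makes this `O(log K)` instead of `O(log n)`
(`log_ratio_le`). The total is of order `n M^{-β(1+α)}`. -/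

theorem confRadius_nonneg (τ : ℕ) (T : ℝ) : 0 ≤ confRadius τ T := by
  unfold confRadius; positivity

theorem confRadius_antitone {T : ℝ} (hT : 0 < T) {a b : ℕ} (ha : 1 ≤ a) (hab : a ≤ b) :
    confRadius b T ≤ confRadius a T := by
  unfold confRadius
  have ha' : (0 : ℝ) < a := by exact_mod_cast ha
  have hab' : (a : ℝ) ≤ b := by exact_mod_cast hab
  have h1 : Real.log (T / b) ≤ Real.log (T / a) :=
    Real.log_le_log (div_pos hT (ha'.trans_le hab')) (by gcongr)
  have h2 : (0 : ℝ) ≤ max (Real.log (T / a)) 1 := le_trans zero_le_one (le_max_right _ _)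
  gcongr

theorem two_le_confRadius_one (T : ℝ) : 2 ≤ confRadius 1 T := by
  unfold confRadius
  have h : (1 : ℝ) ≤ √(2 * max (Real.log (T / (1 : ℕ))) 1 / (1 : ℕ)) := by
    rw [Real.one_le_sqrt]
    have := le_max_right (Real.log (T / (1 : ℕ))) 1
    simp only [Nat.cast_one, div_one] at this ⊢
    linarith
  linarith

theorem sq_confRadius {τ : ℕ} (T : ℝ) :
    confRadius τ T ^ 2 = 8 * max (Real.log (T / τ)) 1 / τ := by
  unfold confRadius
  rw [mul_pow, Real.sq_sqrt (by positivity)]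
  ring

end Radius

/-! ### Successive Elimination along a single path -/

section Path

theorem survivors_nonempty {K : ℕ} {T : ℝ} {τ : ℕ} {S : Finset (Fin K)} (hS : S.Nonempty)
    (m : Fin K → ℝ) : (survivors 1 T τ S m).Nonempty := by
  obtain ⟨i, hi, hmax⟩ := S.exists_max_image m hS
  refine ⟨i, Finset.mem_filter.2 ⟨hi, fun j hj => ?_⟩⟩
  have := hmax j hj
  have := confRadius_nonneg τ T
  linarith

/-- The bookkeeping invariant of Successive Elimination: `N` counts the pulls, and `D` is the sum
of the rewards centred by `μ`. -/
structure SEState.Consistent {K : ℕ} (st : SEState K) (μ : Fin K → ℝ) (N : Fin K → ℕ)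
    (D : Fin K → ℝ) : Prop where
  queue_ne : st.queue ≠ []
  nodup : st.queue.Nodup
  mem_active : ∀ i ∈ st.queue, i ∈ st.active
  count_queue : ∀ i ∈ st.queue, N i + 1 = st.round
  count_done : ∀ i ∈ st.active, i ∉ st.queue → N i = st.round
  mean_eq : ∀ i, N i * (st.mean i - μ i) = D i

theorem startRound_consistent {K : ℕ} {T : ℝ} {τ : ℕ} {S : Finset (Fin K)} {m μ : Fin K → ℝ}
    {N : Fin K → ℕ} {D : Fin K → ℝ} (hS : S.Nonempty) (hN : ∀ i ∈ S, N i + 1 = τ)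
    (hD : ∀ i, N i * (m i - μ i) = D i) :
    (startRound 1 T τ S m).Consistent μ N D := by
  have hsub : survivors 1 T τ S m ⊆ S := Finset.filter_subset _ _
  refine ⟨?_, ?_, ?_, ?_, ?_, hD⟩
  · obtain ⟨i, hi⟩ := survivors_nonempty (T := T) (τ := τ) hS m
    exact List.ne_nil_of_mem ((Finset.mem_sort _).2 hi)
  · exact Finset.sort_nodup _ _
  · intro i hi
    exact (Finset.mem_sort _).1 hi
  · intro i hi
    exact hN i (hsub ((Finset.mem_sort _).1 hi))
  · intro i hi hq
    exact absurd ((Finset.mem_sort _).2 hi) hq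

variable {K : ℕ} [NeZero K]

/-- The state of Successive Elimination with `γ = 1` when it is consulted at the times `t` with
`s t`, the reward vector at time `t` being `y t`. -/
def pathState (T : ℝ) (s : ℕ → Prop) [DecidablePred s] (y : ℕ → Fin K → ℝ) : ℕ → SEState K
  | 0 => startRound 1 T 1 Finset.univ (fun _ => 0)
  | t + 1 =>
    if s t then (pathState T s y t).record 1 T (y t (pathState T s y t).arm)
    else pathState T s y t

/-- The number of pulls of arm `i` before time `t`. -/
def pullCount (T : ℝ) (s : ℕ → Prop) [DecidablePred s] (y : ℕ → Fin K → ℝ) (i : Fin K) : ℕ → ℕ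
  | 0 => 0
  | t + 1 => pullCount T s y i t + if s t ∧ (pathState T s y t).arm = i then 1 else 0

/-- The sum of the rewards of arm `i` before time `t`, each centred by `c`. -/
def deviation (T : ℝ) (s : ℕ → Prop) [DecidablePred s] (y : ℕ → Fin K → ℝ) (c : ℝ) (i : Fin K) :
    ℕ → ℝ
  | 0 => 0
  | t + 1 => deviation T s y c i t + if s t ∧ (pathState T s y t).arm = i then y t i - c else 0

theorem SEState.Consistent.arm_mem {st : SEState K} {μ : Fin K → ℝ} {N : Fin K → ℕ}
    {D : Fin K → ℝ} (h : st.Consistent μ N D) : st.arm ∈ st.queue := by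
  unfold SEState.arm
  cases hq : st.queue with
  | nil => exact absurd hq h.queue_ne
  | cons a q => simp

/-- The averages after recording the reward `y`. -/
def SEState.newMean (st : SEState K) (y : ℝ) : Fin K → ℝ :=
  Function.update st.mean st.arm ((((st.round : ℝ) - 1) * st.mean st.arm + y) / (st.round : ℝ))

theorem SEState.record_of_tail_nil {st : SEState K} {T y : ℝ} (h : st.queue.tail = []) :
    st.record 1 T y = startRound 1 T (st.round + 1) st.active (st.newMean y) := by
  unfold SEState.record
  simp only [h]
  rfl

theorem SEState.record_of_tail_ne {st : SEState K} {T y : ℝ} (h : st.queue.tail ≠ []) :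
    st.record 1 T y = ⟨st.round, st.active, st.queue.tail, st.newMean y⟩ := by
  unfold SEState.record
  cases hq : st.queue.tail with
  | nil => exact absurd hq h
  | cons i q => rfl

theorem SEState.Consistent.newMean_eq {st : SEState K} {μ : Fin K → ℝ} {N : Fin K → ℕ}
    {D : Fin K → ℝ} (h : st.Consistent μ N D) (y : ℝ) (i : Fin K) :
    ((N i + if st.arm = i then 1 else 0 : ℕ) : ℝ) * (st.newMean y i - μ i) =
      D i + if st.arm = i then y - μ i else 0 := by
  rw [← h.mean_eq i]
  unfold SEState.newMean
  by_cases hi : st.arm = i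
  · subst hi
    have hr := h.count_queue _ h.arm_mem
    have hr' : (st.round : ℝ) = N st.arm + 1 := by rw [← hr]; push_cast; ring
    have : (N st.arm : ℝ) + 1 ≠ 0 := by positivity
    simp only [Function.update_self, if_true, hr']
    push_cast
    field_simp
    ring
  · simp [hi, Function.update_of_ne (Ne.symm hi)]

theorem SEState.Consistent.record {st : SEState K} {μ : Fin K → ℝ} {N : Fin K → ℕ}
    {D : Fin K → ℝ} (h : st.Consistent μ N D) (T y : ℝ) :
    (st.record 1 T y).Consistent μ (fun i => N i + if st.arm = i then 1 else 0)
      (fun i => D i + if st.arm = i then y - μ i else 0) := by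
  have hq : st.queue = st.arm :: st.queue.tail := by
    unfold SEState.arm
    cases hq : st.queue with
    | nil => exact absurd hq h.queue_ne
    | cons a q => simp
  have hnd := h.nodup
  rw [hq, List.nodup_cons] at hnd
  have hra := h.count_queue _ h.arm_mem
  by_cases ht : st.queue.tail = []
  · rw [SEState.record_of_tail_nil ht]
    refine startRound_consistent ⟨st.arm, h.mem_active _ h.arm_mem⟩ ?_ (h.newMean_eq y)
    intro i hi
    by_cases hia : st.arm = i
    · subst hia; simp [hra]
    · have : i ∉ st.queue := by
        rw [hq, ht]; simpa using Ne.symm hia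
      simp [hia, h.count_done i hi this]
  · rw [SEState.record_of_tail_ne ht]
    refine ⟨ht, hnd.2, fun i hi => h.mem_active i (List.mem_of_mem_tail hi), ?_, ?_,
      h.newMean_eq y⟩
    · intro i hi
      have hia : st.arm ≠ i := fun e => hnd.1 (e ▸ hi)
      simp [hia, h.count_queue i (List.mem_of_mem_tail hi)]
    · intro i hi hnq
      by_cases hia : st.arm = i
      · subst hia; simp [hra]
      · have : i ∉ st.queue := by
          rw [hq]; simp only [List.mem_cons, not_or]; exact ⟨Ne.symm hia, hnq⟩
        simp [hia, h.count_done i hi this]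

variable (T : ℝ) (s : ℕ → Prop) [DecidablePred s] (y : ℕ → Fin K → ℝ)

theorem pathState_consistent (μ : Fin K → ℝ) (t : ℕ) :
    (pathState T s y t).Consistent μ (fun i => pullCount T s y i t)
      (fun i => deviation T s y (μ i) i t) := by
  induction t with
  | zero =>
    refine startRound_consistent ⟨0, Finset.mem_univ _⟩ ?_ ?_ <;> simp [pullCount, deviation]
  | succ t ih =>
    by_cases hs : s t
    · have := ih.record T (y t (pathState T s y t).arm)
      simp only [pathState, pullCount, deviation, hs, true_and, if_true]
      convert this using 4 with i h
      rw [h]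
    · simpa [pathState, pullCount, deviation, hs] using ih

theorem pullCount_mono (i : Fin K) : Monotone (pullCount T s y i) :=
  monotone_nat_of_le_succ fun t => by simp [pullCount]

/-- The head of the queue still awaits its pull in the current round, so its count lags behind the
round by one. -/
theorem round_eq_pullCount_arm (t : ℕ) :
    (pathState T s y t).round = pullCount T s y (pathState T s y t).arm t + 1 := by
  have h := pathState_consistent T s y 0 t
  exact (h.count_queue _ h.arm_mem).symm

/-- The times at which a round with index in a block is in progress are few. -/
theorem card_round_block_le (n a b : ℕ) :
    ((Finset.range n).filter (fun t => s t ∧ a ≤ (pathState T s y t).round ∧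
      (pathState T s y t).round < b)).card ≤ K * (b - a) := by
  classical
  -- Each pull raises the count of its arm, so arm and round together identify a consultation. This
  -- injects the times into arms × rounds.
  have hinj : ∀ t u, t < u → s t → (pathState T s y t).arm = (pathState T s y u).arm →
      (pathState T s y t).round ≠ (pathState T s y u).round := by
    intro t u htu hs harm
    rw [round_eq_pullCount_arm, round_eq_pullCount_arm, ← harm]
    have h1 := pullCount_mono T s y (pathState T s y t).arm (Nat.succ_le_of_lt htu)
    simp only [pullCount, hs, true_and, if_true] at h1
    omega
  have := Finset.card_le_card_of_injOn
    (s := (Finset.range n).filter (fun t => s t ∧ a ≤ (pathState T s y t).round ∧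
      (pathState T s y t).round < b))
    (t := (Finset.univ : Finset (Fin K)) ×ˢ Finset.Ico a b)
    (fun t => ((pathState T s y t).arm, (pathState T s y t).round)) ?_ ?_
  · simpa using this
  · intro t ht
    have := (Finset.mem_filter.1 (Finset.mem_coe.1 ht)).2
    simp [this]
  · intro t ht u hu htu
    have h1 := (Finset.mem_filter.1 (Finset.mem_coe.1 ht)).2
    have h2 := (Finset.mem_filter.1 (Finset.mem_coe.1 hu)).2
    simp only [Prod.mk.injEq] at htu
    rcases lt_trichotomy t u with h | h | h
    · exact absurd htu.2 (hinj t u h h1.1 htu.1)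
    · exact h
    · exact absurd htu.2.symm (hinj u t h h2.1 htu.1.symm)

/-- The average of arm `i` over its first `m` pulls, all made before time `t`, deviates much
from `c`. -/
def LevelFails (c : ℝ) (i : Fin K) (m t : ℕ) : Prop :=
  ∃ u ≤ t, pullCount T s y i u = m ∧ m * (confRadius (m + 1) T / 2) < |deviation T s y c i u|

variable {T s y}

theorem LevelFails.mono {c : ℝ} {i : Fin K} {m t t' : ℕ} (h : LevelFails T s y c i m t)
    (htt' : t ≤ t') : LevelFails T s y c i m t' := by
  obtain ⟨u, hu, h⟩ := h
  exact ⟨u, hu.trans htt', h⟩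

theorem mean_close_of_not_levelFails {μ : Fin K → ℝ} {i : Fin K} {m t : ℕ} {v : ℝ} (hm : 1 ≤ m)
    (hN : pullCount T s y i t = m) (hv : m * (v - μ i) = deviation T s y (μ i) i t)
    (h : ¬ LevelFails T s y (μ i) i m t) : |v - μ i| ≤ confRadius (m + 1) T / 2 := by
  by_contra! hlt
  refine h ⟨t, le_rfl, hN, ?_⟩
  rw [← hv, abs_mul, Nat.abs_cast]
  have : (0 : ℝ) < m := by exact_mod_cast hm
  gcongr

/-- The test opening round `m + 1` uses averages of `m` pulls and the threshold `U(m+1)`, so errors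
of `U(m+1)/2` cannot eliminate the best arm, and a surviving arm has gap at most `U + U/2 + U/2`.
The second claim needs the first, since the comparison is with `j` as an active arm. Allowing any
`r` up to the current round makes levels from `r` on irrelevant: the active set only shrinks. -/
theorem active_gap_aux {μ : Fin K → ℝ} (hμ : ∀ i, 0 ≤ μ i ∧ μ i ≤ 1) {j : Fin K}
    (hj : ∀ i, μ i ≤ μ j) (t : ℕ) :
    ((∀ m < (pathState T s y t).round, 1 ≤ m → ∀ k, ¬ LevelFails T s y (μ k) k m t) →
      j ∈ (pathState T s y t).active) ∧
    ∀ r, 1 ≤ r → r ≤ (pathState T s y t).round →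
      (∀ m < r, 1 ≤ m → ∀ k, ¬ LevelFails T s y (μ k) k m t) →
      ∀ i ∈ (pathState T s y t).active, μ j - μ i ≤ 2 * confRadius r T := by
  induction t with
  | zero =>
    constructor
    · intro _
      refine Finset.mem_filter.2 ⟨Finset.mem_univ _, fun k _ => ?_⟩
      have := confRadius_nonneg 1 T
      linarith
    · intro r h1 hr _ i _
      have hr' : r ≤ 1 := hr
      obtain rfl : r = 1 := le_antisymm hr' h1
      -- No reward has been seen, but gaps are at most `1` and `U(1)` is at least `2`.
      have := two_le_confRadius_one T
      linarith [(hμ j).2, (hμ i).1]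
  | succ t ih =>
    have hcons := pathState_consistent T s y μ t
    have hcons' := pathState_consistent T s y μ (t + 1)
    by_cases hs : s t
    swap
    · have e : pathState T s y (t + 1) = pathState T s y t := by simp [pathState, hs]
      rw [e]
      refine ⟨fun h => ih.1 fun m hm h1 k hk => h m hm h1 k (hk.mono t.le_succ),
        fun r h1 hr h => ih.2 r h1 hr fun m hm h1 k hk => h m hm h1 k (hk.mono t.le_succ)⟩
    have e : pathState T s y (t + 1) =
        (pathState T s y t).record 1 T (y t (pathState T s y t).arm) := by simp [pathState, hs]
    by_cases ht : (pathState T s y t).queue.tail = []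
    swap
    · rw [SEState.record_of_tail_ne ht] at e
      rw [e]
      refine ⟨fun h => ih.1 fun m hm h1 k hk => h m hm h1 k (hk.mono t.le_succ),
        fun r h1 hr h => ih.2 r h1 hr fun m hm h1 k hk => h m hm h1 k (hk.mono t.le_succ)⟩
    rw [SEState.record_of_tail_nil ht] at e
    set st := pathState T s y t with hst
    set m' := st.newMean (y t st.arm) with hm'
    have hround : (pathState T s y (t + 1)).round = st.round + 1 := by rw [e]; rfl
    have hactive : (pathState T s y (t + 1)).active =
        survivors 1 T (st.round + 1) st.active m' := by rw [e]; rfl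
    have hmean : (pathState T s y (t + 1)).mean = m' := by rw [e]; rfl
    have hr1 : 1 ≤ st.round := by
      rw [hst, round_eq_pullCount_arm]; omega
    have hclose : (∀ m < st.round + 1, 1 ≤ m → ∀ k, ¬ LevelFails T s y (μ k) k m (t + 1)) →
        ∀ k ∈ st.active, |m' k - μ k| ≤ confRadius (st.round + 1) T / 2 := by
      intro h k hk
      -- The recorded pull is the last of its round: its arm reaches the count now, and every other
      -- active arm has already left the queue.
      have hN : pullCount T s y k (t + 1) = st.round := by
        simp only [pullCount, hs, true_and]
        by_cases hka : st.arm = k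
        · subst hka
          rw [← hst, if_pos rfl, hst, round_eq_pullCount_arm]
        · have hq : k ∉ st.queue := by
            intro hkq
            unfold SEState.arm at hka
            cases hq : st.queue with
            | nil => rw [hq] at hkq; simp at hkq
            | cons a q =>
              rw [hq] at ht hka hkq
              simp only [List.tail_cons] at ht
              subst ht
              simp at hka hkq
              exact hka hkq.symm
          rw [← hst, if_neg hka]
          exact hcons.count_done k hk hq
      refine mean_close_of_not_levelFails hr1 hN ?_ (h st.round (Nat.lt_succ_self _) hr1 k)
      rw [← hN, ← hmean]
      exact hcons'.mean_eq k
    have hjact : (∀ m < st.round + 1, 1 ≤ m → ∀ k, ¬ LevelFails T s y (μ k) k m (t + 1)) →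
        j ∈ st.active := fun h =>
      ih.1 fun m hm h1 k hk => h m (hm.trans (Nat.lt_succ_self _)) h1 k (hk.mono t.le_succ)
    constructor
    · intro h
      rw [hround] at h
      rw [hactive]
      refine Finset.mem_filter.2 ⟨hjact h, fun k hk => ?_⟩
      have h1 := abs_le.1 (hclose h k hk)
      have h2 := abs_le.1 (hclose h j (hjact h))
      linarith [hj k]
    · intro r h1 hr h i hi
      rw [hactive] at hi
      have hi' := Finset.mem_filter.1 hi
      rw [hround] at hr
      rcases Nat.lt_or_ge st.round r with hlt | hle
      · obtain rfl : r = st.round + 1 := by omega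
        have h3 := abs_le.1 (hclose h i hi'.1)
        have h2 := abs_le.1 (hclose h j (hjact h))
        have := hi'.2 j (hjact h)
        linarith
      · exact ih.2 r h1 hle (fun m hm h1 k hk => h m hm h1 k (hk.mono t.le_succ)) i hi'.1

/-- The gap of the arm pulled at time `t` is controlled by the index of the current round or by the
first level that fails. -/
theorem gap_arm_le {μ : Fin K → ℝ} (hμ : ∀ i, 0 ≤ μ i ∧ μ i ≤ 1) {j : Fin K}
    (hj : ∀ i, μ i ≤ μ j) (t : ℕ) :
    μ j - μ (pathState T s y t).arm ≤ 2 * confRadius (pathState T s y t).round T ∨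
    ∃ m, 1 ≤ m ∧ m < (pathState T s y t).round ∧ (∃ k, LevelFails T s y (μ k) k m t) ∧
      μ j - μ (pathState T s y t).arm ≤ 2 * confRadius m T := by
  classical
  have hcons := pathState_consistent T s y μ t
  have hact := hcons.mem_active _ hcons.arm_mem
  have hr1 : 1 ≤ (pathState T s y t).round := by rw [round_eq_pullCount_arm]; omega
  have haux := (active_gap_aux (T := T) (s := s) (y := y) hμ hj t).2
  by_cases h : ∃ m, 1 ≤ m ∧ m < (pathState T s y t).round ∧ ∃ k, LevelFails T s y (μ k) k m t
  · right
    have hf := Nat.find_spec h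
    -- All levels below the first failing one are good, so the gap bound of that round is still in
    -- force.
    refine ⟨Nat.find h, hf.1, hf.2.1, hf.2.2, haux _ hf.1 hf.2.1.le ?_ _ hact⟩
    intro m hm h1 k hk
    exact Nat.find_min h hm ⟨h1, hm.trans hf.2.1, k, hk⟩
  · left
    push Not at h
    exact haux _ hr1 le_rfl (fun m hm h1 k hk => h m h1 hm k hk) _ hact

end Path

/-! ### From a failed level to a large exponent -/

section LogMax

/-- The derivative of `u log(T/u)` is `log(T/u) - 1`, and the maximum with `1` takes over just where
it becomes negative. -/
theorem mul_logMax_mono {T u v : ℝ} (hT : 0 < T) (hu : 0 < u) (huv : u ≤ v) :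
    u * max (Real.log (T / u)) 1 ≤ v * max (Real.log (T / v)) 1 := by
  have hv : 0 < v := hu.trans_le huv
  have hmax := le_max_right (Real.log (T / v)) 1
  rcases le_total (Real.log (T / u)) 1 with h | h
  · rw [max_eq_right h]; nlinarith
  · rw [max_eq_left h]
    have e : Real.log (T / u) = Real.log (T / v) + Real.log (v / u) := by
      rw [← Real.log_mul (by positivity) (by positivity)]
      congr 1
      field_simp
    have h1 : Real.log (v / u) ≤ v / u - 1 := Real.log_le_sub_one_of_pos (by positivity)
    have h2 := le_max_left (Real.log (T / v)) 1
    set w := max (Real.log (T / v)) 1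
    have h3 : u * Real.log (v / u) ≤ v - u := by
      calc u * Real.log (v / u) ≤ u * (v / u - 1) := by gcongr
        _ = v - u := by field_simp
    rw [e]
    nlinarith

/-- One slope `U = U(s+1)` serves the whole block `[s, 2s)`, so no union over `m` is needed. Since
`m U(m+1)` is nondecreasing, failure gives `D ≥ sU/2`; the exponent is then at least `sU²/2 - sU²/4
= sU²/4`, which is `2s/(s+1)` times the logarithmic factor. -/
theorem level_exponent_le {T D : ℝ} {s m : ℕ} (hT : 0 < T) (hs : 1 ≤ s) (hsm : s ≤ m)
    (hm : m < 2 * s) (hD : m * (confRadius (m + 1) T / 2) < D) :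
    max (Real.log (T / (s + 1))) 1 ≤
      confRadius (s + 1) T * D - confRadius (s + 1) T ^ 2 / 8 * m := by
  have hs' : (1 : ℝ) ≤ s := by exact_mod_cast hs
  have hsm' : (s : ℝ) ≤ m := by exact_mod_cast hsm
  have hm' : (m : ℝ) ≤ 2 * s := by exact_mod_cast hm.le
  have hU := confRadius_nonneg (s + 1) T
  have hV := confRadius_nonneg (m + 1) T
  have hUsq := sq_confRadius (τ := s + 1) T
  have hVsq := sq_confRadius (τ := m + 1) T
  push_cast at hUsq hVsq
  have hl1 := le_max_right (Real.log (T / (s + 1))) 1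
  have hmono := mul_logMax_mono (u := s + 1) (v := m + 1) hT (by positivity) (by linarith)
  have hx : s * confRadius (s + 1) T ≤ m * confRadius (m + 1) T := by
    refine le_of_sq_le_sq ?_ (by positivity)
    rw [mul_pow, mul_pow, hUsq, hVsq]
    have e1 : ∀ a b : ℝ, 0 ≤ a → a ^ 2 * (8 * b / (a + 1)) = 8 * (a / (a + 1)) ^ 2 * ((a + 1) * b)
    · intro a b ha
      field_simp
    rw [e1 _ _ (by positivity), e1 _ _ (by positivity)]
    have : (s : ℝ) / (s + 1) ≤ m / (m + 1) := by
      rw [div_le_div_iff₀ (by positivity) (by positivity)]; nlinarith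
    have h0 : 0 ≤ ((s : ℝ) + 1) * max (Real.log (T / (s + 1))) 1 := by positivity
    gcongr
  set U := confRadius (s + 1) T
  have h1 : s * U / 2 ≤ D := by linarith
  have h2 : U * (s * U / 2) ≤ U * D := by gcongr
  have h3 : U ^ 2 / 8 * m ≤ U ^ 2 / 8 * (2 * s) := by gcongr
  have h4 : U ^ 2 * s / 4 = 2 * s / (s + 1) * max (Real.log (T / (s + 1))) 1 := by
    rw [hUsq]; ring
  have h5 : 1 ≤ 2 * (s : ℝ) / (s + 1) := by
    rw [le_div_iff₀ (by positivity)]; linarith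
  nlinarith

end LogMax

/-! ### Maximal inequality -/

section Ville

variable {Ω : Type*} {m0 : MeasurableSpace Ω} {P : Measure Ω}

open scoped ENNReal

/-- The maximal inequality for nonnegative supermartingales. -/
theorem maximal_ineq_of_setLIntegral_le (ℱ : ℕ → MeasurableSpace Ω) (hmono : Monotone ℱ)
    (hle : ∀ t, ℱ t ≤ m0) (W : ℕ → Ω → ℝ≥0∞) (hW : ∀ t, Measurable[ℱ t] (W t))
    (hstep : ∀ t, ∀ B, MeasurableSet[ℱ t] B → ∫⁻ ω in B, W (t + 1) ω ∂P ≤ ∫⁻ ω in B, W t ω ∂P)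
    (c : ℝ≥0∞) (n : ℕ) :
    c * P {ω | ∃ t ≤ n, c ≤ W t ω} ≤ ∫⁻ ω, W 0 ω ∂P := by
  have hmeas : ∀ n, MeasurableSet[ℱ n] {ω | ∃ t ≤ n, c ≤ W t ω} := by
    intro n
    have : {ω | ∃ t ≤ n, c ≤ W t ω} = ⋃ t ∈ Set.Iic n, {ω | c ≤ W t ω} := by
      ext ω; simp
    rw [this]
    refine MeasurableSet.biUnion (Set.to_countable _) fun t ht => ?_
    exact hmono ht _ (hW t measurableSet_Ici)
  -- The induction has to carry the mass on the paths that have not crossed `c`: this part pays for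
  -- later crossings.
  suffices h : c * P {ω | ∃ t ≤ n, c ≤ W t ω} +
      ∫⁻ ω in {ω | ∃ t ≤ n, c ≤ W t ω}ᶜ, W n ω ∂P ≤ ∫⁻ ω, W 0 ω ∂P from
    le_trans le_self_add h
  induction n with
  | zero =>
    have hm : MeasurableSet {ω | ∃ t ≤ 0, c ≤ W t ω} := hle 0 _ (hmeas 0)
    rw [← lintegral_add_compl (μ := P) (W 0) hm]
    refine add_le_add ?_ le_rfl
    rw [← setLIntegral_const]
    refine setLIntegral_mono' hm fun ω hω => ?_
    obtain ⟨t, ht, hc⟩ := hω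
    obtain rfl : t = 0 := by omega
    exact hc
  | succ n ih =>
    refine le_trans ?_ ih
    set S := {ω | ∃ t ≤ n, c ≤ W t ω} with hS
    set S' := {ω | ∃ t ≤ n + 1, c ≤ W t ω} with hS'
    have hSm : MeasurableSet S := hle n _ (hmeas n)
    have hSm' : MeasurableSet S' := hle (n + 1) _ (hmeas (n + 1))
    have hsub : S ⊆ S' := fun ω ⟨t, ht, h⟩ => ⟨t, ht.trans n.le_succ, h⟩
    have hD : MeasurableSet (S' \ S) := hSm'.diff hSm
    have h1 : P S' = P S + P (S' \ S) := by
      rw [← measure_union disjoint_sdiff_self_right hD, Set.union_sdiff_cancel hsub]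
    have h2 : c * P (S' \ S) ≤ ∫⁻ ω in S' \ S, W (n + 1) ω ∂P := by
      rw [← setLIntegral_const]
      refine setLIntegral_mono' hD fun ω hω => ?_
      obtain ⟨⟨t, ht, hc⟩, hn⟩ := hω
      rcases Nat.lt_or_ge n t with h | h
      · obtain rfl : t = n + 1 := by omega
        exact hc
      · exact absurd ⟨t, h, hc⟩ hn
    have h3 : ∫⁻ ω in S' \ S, W (n + 1) ω ∂P + ∫⁻ ω in S'ᶜ, W (n + 1) ω ∂P =
        ∫⁻ ω in Sᶜ, W (n + 1) ω ∂P := by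
      rw [← lintegral_union hSm'.compl]
      · congr 2
        ext ω
        have := @hsub ω
        simp only [Set.mem_union, Set.mem_sdiff, Set.mem_compl_iff]
        tauto
      · exact Set.disjoint_left.2 fun ω h h' => h' h.1
    calc c * P S' + ∫⁻ ω in S'ᶜ, W (n + 1) ω ∂P
        ≤ c * P S + (∫⁻ ω in S' \ S, W (n + 1) ω ∂P + ∫⁻ ω in S'ᶜ, W (n + 1) ω ∂P) := by
          rw [h1, mul_add, add_assoc]; gcongr
      _ ≤ c * P S + ∫⁻ ω in Sᶜ, W n ω ∂P := by
          rw [h3]; exact add_le_add le_rfl (hstep n _ (hmeas n).compl)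

end Ville

/-! ### Measurability of the state with respect to the past -/

section Adapted

variable {Ω : Type*} {K : ℕ}

/-- The discrete part of a state. -/
def SEState.code (st : SEState K) : ℕ × Finset (Fin K) × List (Fin K) :=
  (st.round, st.active, st.queue)

/-- All components of a random state are measurable. -/
structure AdaptedState (m : MeasurableSpace Ω) (st : Ω → SEState K) : Prop where
  code : ∀ A : Set (ℕ × Finset (Fin K) × List (Fin K)), MeasurableSet[m] {ω | (st ω).code ∈ A}
  mean : ∀ i, Measurable[m] fun ω => (st ω).mean i

theorem AdaptedState.of_code_eq {m : MeasurableSpace Ω} {st : Ω → SEState K}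
    (h : ∀ c, MeasurableSet[m] {ω | (st ω).code = c})
    (hmean : ∀ i, Measurable[m] fun ω => (st ω).mean i) : AdaptedState m st := by
  refine ⟨fun A => ?_, hmean⟩
  have : {ω | (st ω).code ∈ A} = ⋃ c ∈ A, {ω | (st ω).code = c} := by ext ω; simp
  rw [this]
  exact MeasurableSet.biUnion A.to_countable fun c _ => h c

theorem AdaptedState.mono {m m' : MeasurableSpace Ω} {st : Ω → SEState K}
    (h : AdaptedState m st) (hm : m ≤ m') : AdaptedState m' st :=
  ⟨fun A => hm _ (h.code A), fun i => (h.mean i).mono hm le_rfl⟩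

theorem AdaptedState.ite {m : MeasurableSpace Ω} {st st' : Ω → SEState K} {s : Ω → Prop}
    [DecidablePred s] (hs : MeasurableSet[m] {ω | s ω}) (h : AdaptedState m st)
    (h' : AdaptedState m st') : AdaptedState m (fun ω => if s ω then st ω else st' ω) := by
  constructor
  · intro A
    have : {ω | (if s ω then st ω else st' ω).code ∈ A} =
        ({ω | s ω} ∩ {ω | (st ω).code ∈ A}) ∪ ({ω | s ω}ᶜ ∩ {ω | (st' ω).code ∈ A}) := by
      ext ω
      by_cases hω : s ω <;> simp [hω]
    rw [this]
    exact (hs.inter (h.code A)).union (hs.compl.inter (h'.code A))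
  · intro i
    have : (fun ω => (if s ω then st ω else st' ω).mean i) =
        fun ω => if s ω then (st ω).mean i else (st' ω).mean i := by
      ext ω; split_ifs <;> rfl
    rw [this]
    exact Measurable.ite hs (h.mean i) (h'.mean i)

theorem AdaptedState.measurable_round {m : MeasurableSpace Ω} {st : Ω → SEState K}
    (h : AdaptedState m st) : Measurable[m] fun ω => (st ω).round := by
  refine @measurable_to_countable' _ _ _ _ m _ fun r => h.code {c | c.1 = r}

theorem measurableSet_survivors_eq {m : MeasurableSpace Ω} (T : ℝ) (τ : ℕ) (S A : Finset (Fin K))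
    {v : Ω → Fin K → ℝ} (hv : ∀ i, Measurable[m] fun ω => v ω i) :
    MeasurableSet[m] {ω | survivors 1 T τ S (v ω) = A} := by
  classical
  have : {ω | survivors 1 T τ S (v ω) = A} =
      ⋂ i, {ω | (i ∈ S ∧ ∀ j, j ∈ S → v ω j - 1 * confRadius τ T ≤ v ω i) ↔ i ∈ A} := by
    ext ω
    simp [survivors, Finset.ext_iff]
  rw [this]
  refine MeasurableSet.iInter fun i => ?_
  refine MeasurableSet.iff (MeasurableSet.inter (.const _) ?_) (.const _)
  have : {ω | ∀ j, j ∈ S → v ω j - 1 * confRadius τ T ≤ v ω i} =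
      ⋂ j, {ω | j ∈ S → v ω j - 1 * confRadius τ T ≤ v ω i} := by ext ω; simp
  change MeasurableSet[m] {ω | ∀ j, j ∈ S → v ω j - 1 * confRadius τ T ≤ v ω i}
  rw [this]
  refine MeasurableSet.iInter fun j => MeasurableSet.imp (.const _) ?_
  exact measurableSet_le ((hv j).sub measurable_const) (hv i)

theorem adaptedState_const {m : MeasurableSpace Ω} (st : SEState K) :
    AdaptedState m (fun _ : Ω => st) :=
  ⟨fun _ => .const _, fun _ => measurable_const⟩

variable [NeZero K]

theorem AdaptedState.measurableSet_arm {m : MeasurableSpace Ω} {st : Ω → SEState K}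
    (h : AdaptedState m st) (i : Fin K) : MeasurableSet[m] {ω | (st ω).arm = i} :=
  h.code {c | c.2.2.headD 0 = i}

/-- The old code takes countably many values. Given it, the new code depends only on the surviving
set, that is, on finitely many inequalities between averages. -/
theorem AdaptedState.record {m : MeasurableSpace Ω} {st : Ω → SEState K}
    (h : AdaptedState m st) (T : ℝ) {y : Fin K → Ω → ℝ} (hy : ∀ i, Measurable[m] (y i)) :
    AdaptedState m (fun ω => (st ω).record 1 T (y (st ω).arm ω)) := by
  have hmean : ∀ i, Measurable[m] fun ω => (st ω).newMean (y (st ω).arm ω) i := by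
    intro i
    have e : (fun ω => (st ω).newMean (y (st ω).arm ω) i) = fun ω => if (st ω).arm = i then
        ((((st ω).round : ℝ) - 1) * (st ω).mean i + y i ω) / ((st ω).round : ℝ)
        else (st ω).mean i := by
      ext ω
      unfold SEState.newMean
      split_ifs with hi
      · subst hi; simp
      · rw [Function.update_of_ne (Ne.symm hi)]
    rw [e]
    have hr : Measurable[m] fun ω => ((st ω).round : ℝ) :=
      measurable_from_top.comp h.measurable_round
    exact Measurable.ite (h.measurableSet_arm i)
      ((((hr.sub measurable_const).mul (h.mean i)).add (hy i)).div hr) (h.mean i)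
  have hrec : ∀ ω, ((st ω).record 1 T (y (st ω).arm ω)).mean =
      (st ω).newMean (y (st ω).arm ω) := by
    intro ω
    by_cases ht : (st ω).queue.tail = []
    · rw [SEState.record_of_tail_nil ht]; rfl
    · rw [SEState.record_of_tail_ne ht]
  refine AdaptedState.of_code_eq (fun c => ?_) (fun i => by simpa only [hrec] using hmean i)
  have e : {ω | ((st ω).record 1 T (y (st ω).arm ω)).code = c} =
      ⋃ c' : ℕ × Finset (Fin K) × List (Fin K), {ω | (st ω).code = c'} ∩
        {ω | (c'.2.2.tail = [] ∧ c.1 = c'.1 + 1 ∧ c.2.2 = c.2.1.sort (· ≤ ·) ∧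
          survivors 1 T (c'.1 + 1) c'.2.1 ((st ω).newMean (y (st ω).arm ω)) = c.2.1) ∨
          (c'.2.2.tail ≠ [] ∧ c = (c'.1, c'.2.1, c'.2.2.tail))} := by
    ext ω
    simp only [Set.mem_ofPred_eq, Set.mem_iUnion, Set.mem_inter_iff]
    rw [exists_eq_left']
    obtain ⟨c1, c2, c3⟩ := c
    by_cases ht : (st ω).queue.tail = []
    · rw [SEState.record_of_tail_nil ht]
      simp only [SEState.code, startRound, ht, ne_eq, not_true_eq_false, false_and, or_false,
        true_and, Prod.mk.injEq]
      constructor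
      · rintro ⟨rfl, rfl, rfl⟩; exact ⟨rfl, rfl, rfl⟩
      · rintro ⟨rfl, rfl, rfl⟩; exact ⟨rfl, rfl, rfl⟩
    · rw [SEState.record_of_tail_ne ht]
      simp only [SEState.code, ht, false_and, false_or, ne_eq, not_false_eq_true, true_and]
      exact eq_comm
  rw [e]
  refine MeasurableSet.iUnion fun c' => (h.code {c'}).inter ?_
  refine MeasurableSet.union ?_ (.const _)
  refine MeasurableSet.inter (.const _)
    (MeasurableSet.inter (.const _) (MeasurableSet.inter (.const _) ?_))
  exact measurableSet_survivors_eq T _ _ _ hmean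

variable (ℱ : ℕ → MeasurableSpace Ω) (hmono : Monotone ℱ) (T : ℝ) {s : ℕ → Ω → Prop}
  [∀ ω, DecidablePred fun t => s t ω] {y : ℕ → Fin K → Ω → ℝ}
  (hs : ∀ t, MeasurableSet[ℱ (t + 1)] {ω | s t ω}) (hy : ∀ t i, Measurable[ℱ (t + 1)] (y t i))

include hmono hs hy

theorem adaptedState_pathState (t : ℕ) :
    AdaptedState (ℱ t) (fun ω => pathState T (fun t => s t ω) (fun t i => y t i ω) t) := by
  induction t with
  | zero => exact adaptedState_const _
  | succ t ih =>
    have ih' := ih.mono (hmono t.le_succ)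
    let : DecidablePred (s t) := fun ω => inferInstanceAs (Decidable ((fun t => s t ω) t))
    have := AdaptedState.ite (hs t) (ih'.record T (hy t)) ih'
    convert this using 2
    rfl

theorem measurable_pullCount (i : Fin K) (t : ℕ) :
    Measurable[ℱ t] (fun ω => pullCount T (fun t => s t ω) (fun t i => y t i ω) i t) := by
  classical
  induction t with
  | zero => exact measurable_const
  | succ t ih =>
    simp only [pullCount]
    refine (ih.mono (hmono t.le_succ) le_rfl).add (Measurable.ite ?_ measurable_const
      measurable_const)
    exact (hs t).inter (hmono t.le_succ _
      ((adaptedState_pathState ℱ hmono T hs hy t).measurableSet_arm i))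

theorem measurable_deviation (c : ℝ) (i : Fin K) (t : ℕ) :
    Measurable[ℱ t] (fun ω => deviation T (fun t => s t ω) (fun t i => y t i ω) c i t) := by
  classical
  induction t with
  | zero => exact measurable_const
  | succ t ih =>
    simp only [deviation]
    refine (ih.mono (hmono t.le_succ) le_rfl).add (Measurable.ite ?_
      ((hy t i).sub measurable_const) measurable_const)
    exact (hs t).inter (hmono t.le_succ _
      ((adaptedState_pathState ℱ hmono T hs hy t).measurableSet_arm i))

end Adapted

/-! ### Bins as measurable sets -/

section Bins

variable {d : ℕ}

theorem measurable_binIndex (M : ℕ) : Measurable (binIndex (d := d) M) := by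
  refine measurable_pi_lambda _ fun l => ?_
  have h1 : Measurable fun x : Pt d => (M : ℝ) * x l := by fun_prop
  have h2 : Measurable fun x : Pt d => ⌊(M : ℝ) * x l⌋₊ := Nat.measurable_floor.comp h1
  exact (measurable_from_top (f := fun k : ℕ => min k (M - 1))).comp h2

/-- The bin with index `b`. -/
def binSet (d M : ℕ) (b : Fin d → ℕ) : Set (Pt d) := {x | binIndex M x = b}

theorem mem_binSet {M : ℕ} {b : Fin d → ℕ} {x : Pt d} : x ∈ binSet d M b ↔ binIndex M x = b :=
  Iff.rfl

theorem measurableSet_binSet (M : ℕ) (b : Fin d → ℕ) : MeasurableSet (binSet d M b) :=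
  measurable_binIndex M (measurableSet_singleton b)

end Bins

/-! ### Concentration of the rewards of an arm within a bin -/

section Machine

variable {d K : ℕ} {Ω : Type*} {X : ℕ → Ω → Pt d} {Y : ℕ → Fin K → Ω → ℝ}

/-- The vector `(X t, Y t 1, …, Y t K)`. -/
def obs (X : ℕ → Ω → Pt d) (Y : ℕ → Fin K → Ω → ℝ) (t : ℕ) (ω : Ω) : Pt d × (Fin K → ℝ) :=
  (X t ω, fun i => Y t i ω)

/-- The `σ`-algebra generated by the vectors before time `t`. -/
abbrev past (X : ℕ → Ω → Pt d) (Y : ℕ → Fin K → Ω → ℝ) (t : ℕ) : MeasurableSpace Ω :=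
  ⨆ u ∈ Set.Iio t, MeasurableSpace.comap (obs X Y u) inferInstance

theorem past_mono : Monotone (past X Y) := fun _ _ h =>
  biSup_mono fun _ hu => lt_of_lt_of_le hu h

theorem measurable_obs_past (t : ℕ) : Measurable[past X Y (t + 1)] (obs X Y t) :=
  (comap_measurable (obs X Y t)).mono
    (le_biSup (fun u => MeasurableSpace.comap (obs X Y u) inferInstance)
      (Set.mem_Iio.2 t.lt_succ_self)) le_rfl

theorem measurableSet_bin_past (M : ℕ) (b : Fin d → ℕ) (t : ℕ) :
    MeasurableSet[past X Y (t + 1)] {ω | binIndex M (X t ω) = b} :=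
  (measurable_fst.comp (measurable_obs_past (X := X) (Y := Y) t)) (measurableSet_binSet M b)

theorem measurable_reward_past (t : ℕ) (i : Fin K) :
    Measurable[past X Y (t + 1)] (Y t i) :=
  (measurable_pi_apply i).comp (measurable_snd.comp (measurable_obs_past (X := X) (Y := Y) t))

section State

variable [NeZero K]

/-- The state of Successive Elimination in the bin `b` at time `t`. -/
abbrev binState (X : ℕ → Ω → Pt d) (Y : ℕ → Fin K → Ω → ℝ) (T : ℝ) (M : ℕ) (b : Fin d → ℕ)
    (t : ℕ) (ω : Ω) : SEState K :=
  pathState T (fun u => binIndex M (X u ω) = b) (fun u i => Y u i ω) t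

/-- The number of pulls of arm `i` in the bin `b` before time `t`. -/
abbrev binCountArm (X : ℕ → Ω → Pt d) (Y : ℕ → Fin K → Ω → ℝ) (T : ℝ) (M : ℕ) (b : Fin d → ℕ)
    (i : Fin K) (t : ℕ) (ω : Ω) : ℕ :=
  pullCount T (fun u => binIndex M (X u ω) = b) (fun u i => Y u i ω) i t

/-- The sum of the rewards of arm `i`, centred by `c`, in the bin `b` before time `t`. -/
abbrev binDeviation (X : ℕ → Ω → Pt d) (Y : ℕ → Fin K → Ω → ℝ) (T : ℝ) (M : ℕ) (b : Fin d → ℕ)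
    (c : ℝ) (i : Fin K) (t : ℕ) (ω : Ω) : ℝ :=
  deviation T (fun u => binIndex M (X u ω) = b) (fun u i => Y u i ω) c i t

theorem adaptedState_binState (T : ℝ) (M : ℕ) (b : Fin d → ℕ) (t : ℕ) :
    AdaptedState (past X Y t) (binState X Y T M b t) :=
  adaptedState_pathState (past X Y) past_mono T (s := fun u ω => binIndex M (X u ω) = b)
    (measurableSet_bin_past M b) measurable_reward_past t

theorem measurable_binCountArm (T : ℝ) (M : ℕ) (b : Fin d → ℕ) (i : Fin K) (t : ℕ) :
    Measurable[past X Y t] (binCountArm X Y T M b i t) :=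
  measurable_pullCount (past X Y) past_mono T (s := fun u ω => binIndex M (X u ω) = b)
    (measurableSet_bin_past M b) measurable_reward_past i t

theorem measurable_binDeviation (T : ℝ) (M : ℕ) (b : Fin d → ℕ) (c : ℝ) (i : Fin K) (t : ℕ) :
    Measurable[past X Y t] (binDeviation X Y T M b c i t) :=
  measurable_deviation (past X Y) past_mono T (s := fun u ω => binIndex M (X u ω) = b)
    (measurableSet_bin_past M b) measurable_reward_past c i t

/-- The exponential supermartingale of arm `i` in the bin `b`. -/
def expProcess (X : ℕ → Ω → Pt d) (Y : ℕ → Fin K → Ω → ℝ) (T : ℝ) (M : ℕ) (b : Fin d → ℕ)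
    (c : ℝ) (i : Fin K) (l : ℝ) (t : ℕ) (ω : Ω) : ENNReal :=
  ENNReal.ofReal (Real.exp (l * binDeviation X Y T M b c i t ω -
    l ^ 2 / 8 * binCountArm X Y T M b i t ω))

theorem measurable_expProcess (T : ℝ) (M : ℕ) (b : Fin d → ℕ) (c : ℝ) (i : Fin K) (l : ℝ)
    (t : ℕ) : Measurable[past X Y t] (expProcess X Y T M b c i l t) := by
  refine ENNReal.measurable_ofReal.comp (Real.measurable_exp.comp ?_)
  exact ((measurable_binDeviation T M b c i t).const_mul l).sub
    ((measurable_from_top.comp (measurable_binCountArm T M b i t)).const_mul _)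

theorem expProcess_succ (T : ℝ) (M : ℕ) (b : Fin d → ℕ) (c : ℝ) (i : Fin K) (l : ℝ)
    (t : ℕ) (ω : Ω) : expProcess X Y T M b c i l (t + 1) ω =
      if (binState X Y T M b t ω).arm = i then expProcess X Y T M b c i l t ω *
        (if binIndex M (X t ω) = b then
          ENNReal.ofReal (Real.exp (l * (Y t i ω - c) - l ^ 2 / 8)) else 1)
      else expProcess X Y T M b c i l t ω := by
  unfold expProcess binDeviation binCountArm
  simp only [deviation, pullCount]
  by_cases h1 : binIndex M (X t ω) = b <;> by_cases h2 : (binState X Y T M b t ω).arm = i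
  · simp only [h1, h2, and_self, if_true]
    rw [← ENNReal.ofReal_mul (by positivity), ← Real.exp_add]
    congr 2
    push_cast
    ring
  all_goals simp [h1, h2]

end State

variable [MeasurableSpace Ω] {P : Measure Ω} {PX : Measure (Pt d)} {f : Fin K → Pt d → ℝ}

namespace IsMachine

variable (h : IsMachine P X Y PX f)
include h

theorem measurable_obs (t : ℕ) : Measurable (obs X Y t) :=
  (h.measurable_X t).prodMk (measurable_pi_lambda _ fun i => h.measurable_Y t i)

theorem past_le (t : ℕ) : past X Y t ≤ ‹MeasurableSpace Ω› :=
  iSup₂_le fun u _ => (h.measurable_obs u).comap_le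

theorem indep_past (t : ℕ) :
    Indep (past X Y t) (MeasurableSpace.comap (obs X Y t) inferInstance) P := by
  have := indep_iSup_of_disjoint (m := fun u => MeasurableSpace.comap (obs X Y u) inferInstance)
    (fun u => (h.measurable_obs u).comap_le) h.indep (S := Set.Iio t) (T := {t}) (by simp)
  simpa [past] using this

open scoped ENNReal in
theorem lintegral_past_mul (t : ℕ) {g : Ω → ℝ≥0∞} (hg : Measurable[past X Y t] g)
    {φ : Pt d × (Fin K → ℝ) → ℝ≥0∞} (hφ : Measurable φ) :
    ∫⁻ ω, g ω * φ (obs X Y t ω) ∂P = (∫⁻ ω, g ω ∂P) * ∫⁻ ω, φ (obs X Y t ω) ∂P :=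
  lintegral_mul_eq_lintegral_mul_lintegral_of_independent_measurableSpace (h.past_le t)
    (h.measurable_obs t).comap_le (h.indep_past t) hg (hφ.comp (comap_measurable _))

theorem isProbabilityMeasure_PX : IsProbabilityMeasure PX := by
  have := h.isProb
  rw [← h.law_X 0]
  exact Measure.isProbabilityMeasure_map (h.measurable_X 0).aemeasurable

theorem measure_preimage (t : ℕ) {B : Set (Pt d)} (hB : MeasurableSet B) :
    P (X t ⁻¹' B) = PX B := by
  rw [← h.law_X t, Measure.map_apply (h.measurable_X t) hB]

theorem integrable_Y (t : ℕ) (i : Fin K) : Integrable (Y t i) P := by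
  have := h.isProb
  exact Integrable.of_mem_Icc 0 1 (h.measurable_Y t i).aemeasurable (h.reward_mem t i)

/-- This identifies the mean of a reward given only that the covariate is in `B`: it is the average
of `f i` over `B`. Centring at this average, not at `f i x`, leaves no bias term in the bin. -/
theorem setIntegral_Y (t : ℕ) (i : Fin K) (hf : AEStronglyMeasurable (f i) PX) {B : Set (Pt d)}
    (hB : MeasurableSet B) : ∫ ω in X t ⁻¹' B, Y t i ω ∂P = ∫ x in B, f i x ∂PX := by
  have := h.isProb
  have hle : MeasurableSpace.comap (X t) inferInstance ≤ ‹MeasurableSpace Ω› :=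
    (h.measurable_X t).comap_le
  rw [← setIntegral_condExp hle (h.integrable_Y t i) ⟨B, hB, rfl⟩,
    setIntegral_congr_ae (g := fun ω => f i (X t ω)) (h.measurable_X t hB)
      ((h.condMean t i).mono fun ω hω _ => hω)]
  rw [← h.law_X t] at hf ⊢
  rw [setIntegral_map hB hf (h.measurable_X t).aemeasurable]

/-- Hoeffding's lemma for the reward in a bin. -/
theorem lintegral_exp_le_one (t : ℕ) (i : Fin K) (hf : AEStronglyMeasurable (f i) PX)
    {B : Set (Pt d)} (hB : MeasurableSet B) [DecidablePred (· ∈ B)] (l : ℝ) :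
    ∫⁻ ω, (if X t ω ∈ B then
      ENNReal.ofReal (Real.exp (l * (Y t i ω - ⨍ x in B, f i x ∂PX) - l ^ 2 / 8)) else 1) ∂P ≤ 1 := by
  have := h.isProb
  set A := X t ⁻¹' B with hA
  have hAm : MeasurableSet A := h.measurable_X t hB
  set c := ⨍ x in B, f i x ∂PX with hc
  rw [← lintegral_add_compl (μ := P) _ hAm]
  have h1 : ∫⁻ ω in A, (if X t ω ∈ B then
      ENNReal.ofReal (Real.exp (l * (Y t i ω - c) - l ^ 2 / 8)) else 1) ∂P =
      ∫⁻ ω in A, ENNReal.ofReal (Real.exp (l * (Y t i ω - c) - l ^ 2 / 8)) ∂P :=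
    setLIntegral_congr_fun hAm fun ω hω => if_pos hω
  have h2 : ∫⁻ ω in Aᶜ, (if X t ω ∈ B then
      ENNReal.ofReal (Real.exp (l * (Y t i ω - c) - l ^ 2 / 8)) else 1) ∂P = P Aᶜ := by
    rw [← setLIntegral_one]
    exact setLIntegral_congr_fun hAm.compl fun ω hω => if_neg hω
  rw [h1, h2]
  suffices h3 : ∫⁻ ω in A, ENNReal.ofReal (Real.exp (l * (Y t i ω - c) - l ^ 2 / 8)) ∂P ≤ P A by
    calc _ ≤ P A + P Aᶜ := add_le_add h3 le_rfl
      _ = 1 := prob_add_prob_compl hAm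
  rcases eq_or_ne (P A) 0 with h0 | h0
  · rw [Measure.restrict_eq_zero.2 h0]; simp
  -- Under the law conditioned on the bin, the reward lies in `[0,1]` and has mean `c`, so its
  -- variance proxy is `1/4`.
  have hQ : IsProbabilityMeasure (P[|A]) := cond_isProbabilityMeasure h0
  have hac : P[|A] ≪ P := cond_absolutelyContinuous
  have hcQ : c = (P[|A])[Y t i] := by
    rw [hc, setAverage_eq, ← h.setIntegral_Y t i hf hB, Measure.real, ← h.measure_preimage t hB,
      ProbabilityTheory.cond, integral_smul_measure, ENNReal.toReal_inv]
  have hsub : HasSubgaussianMGF (fun ω => Y t i ω - c) ((‖(1 : ℝ) - 0‖₊ / 2) ^ 2) (P[|A]) := by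
    rw [hcQ]
    exact hasSubgaussianMGF_of_mem_Icc (h.measurable_Y t i).aemeasurable
      (hac (h.reward_mem t i))
  have hmgf := hsub.mgf_le l
  have hint := hsub.integrable_exp_mul l
  have e : P.restrict A = P A • P[|A] := by
    rw [ProbabilityTheory.cond, smul_smul, ENNReal.mul_inv_cancel h0 (measure_ne_top _ _),
      one_smul]
  rw [e, lintegral_smul_measure]
  have h4 : ∀ ω, Real.exp (l * (Y t i ω - c) - l ^ 2 / 8) =
      Real.exp (-(l ^ 2 / 8)) * Real.exp (l * (Y t i ω - c)) := fun ω => by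
    rw [← Real.exp_add]; ring_nf
  have h5 : ∫⁻ ω, ENNReal.ofReal (Real.exp (l * (Y t i ω - c) - l ^ 2 / 8)) ∂(P[|A]) ≤ 1 := by
    simp_rw [h4]
    rw [← ofReal_integral_eq_lintegral_ofReal (hint.const_mul _)
      (Filter.Eventually.of_forall fun ω => by positivity), integral_const_mul]
    rw [ENNReal.ofReal_le_one]
    have h6 : (((‖(1 : ℝ) - 0‖₊ / 2) ^ 2 : NNReal) : ℝ) * l ^ 2 / 2 = l ^ 2 / 8 := by
      push_cast; norm_num; ring
    rw [h6] at hmgf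
    calc Real.exp (-(l ^ 2 / 8)) * ∫ ω, Real.exp (l * (Y t i ω - c)) ∂(P[|A])
        ≤ Real.exp (-(l ^ 2 / 8)) * Real.exp (l ^ 2 / 8) := by gcongr; exact hmgf
      _ = 1 := by rw [← Real.exp_add]; simp
  calc P A • _ ≤ P A • (1 : ENNReal) := by gcongr
    _ = P A := by simp

end IsMachine

variable [NeZero K]

namespace IsMachine

variable (h : IsMachine P X Y PX f)
include h

/-- Whether arm `i` is next in the bin is decided by the past. If it is, the new factor is a
function of the independent observation at time `t` with mean at most `1`; otherwise the process
does not move. -/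
theorem setLIntegral_expProcess_le (T : ℝ) (M : ℕ) (b : Fin d → ℕ) (i : Fin K)
    (hf : AEStronglyMeasurable (f i) PX) (l : ℝ) (t : ℕ) {E : Set Ω}
    (hE : MeasurableSet[past X Y t] E) :
    ∫⁻ ω in E, expProcess X Y T M b (⨍ x in binSet d M b, f i x ∂PX) i l (t + 1) ω ∂P ≤
      ∫⁻ ω in E, expProcess X Y T M b (⨍ x in binSet d M b, f i x ∂PX) i l t ω ∂P := by
  classical
  set c := ⨍ x in binSet d M b, f i x ∂PX with hc
  set A : Set Ω := {ω | (binState X Y T M b t ω).arm = i} with hA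
  have hAm : MeasurableSet[past X Y t] A := (adaptedState_binState T M b t).measurableSet_arm i
  have hAm' := h.past_le t _ hAm
  have hEm' := h.past_le t _ hE
  rw [← lintegral_inter_add_sdiff (μ := P) _ E hAm',
    ← lintegral_inter_add_sdiff (μ := P) (expProcess X Y T M b c i l t) E hAm']
  refine add_le_add ?_ (le_of_eq ?_)
  · set φ : Pt d × (Fin K → ℝ) → ENNReal := fun z => if binIndex M z.1 = b then
      ENNReal.ofReal (Real.exp (l * (z.2 i - c) - l ^ 2 / 8)) else 1 with hφ
    have hφm : Measurable φ := by
      refine Measurable.ite (measurable_fst (measurableSet_binSet M b)) ?_ measurable_const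
      fun_prop
    have e1 : ∫⁻ ω in E ∩ A, expProcess X Y T M b c i l (t + 1) ω ∂P =
        ∫⁻ ω, (E ∩ A).indicator (expProcess X Y T M b c i l t) ω *
          φ (obs X Y t ω) ∂P := by
      rw [← lintegral_indicator (hEm'.inter hAm')]
      refine lintegral_congr fun ω => ?_
      by_cases hω : ω ∈ E ∩ A
      · have hi : (binState X Y T M b t ω).arm = i := hω.2
        rw [Set.indicator_of_mem hω, Set.indicator_of_mem hω, expProcess_succ, if_pos hi]
        rfl
      · rw [Set.indicator_of_notMem hω, Set.indicator_of_notMem hω, zero_mul]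
    rw [e1, h.lintegral_past_mul t
      ((measurable_expProcess T M b c i l t).indicator (hE.inter hAm)) hφm,
      lintegral_indicator (hEm'.inter hAm')]
    calc _ ≤ (∫⁻ ω in E ∩ A, expProcess X Y T M b c i l t ω ∂P) * 1 := by
          gcongr
          let : DecidablePred (· ∈ binSet d M b) :=
            fun x => inferInstanceAs (Decidable (binIndex M x = b))
          exact h.lintegral_exp_le_one t i hf (measurableSet_binSet M b) l
      _ = _ := mul_one _
  · refine setLIntegral_congr_fun (hEm'.diff hAm') fun ω hω => ?_
    simp only [expProcess_succ]
    exact if_neg hω.2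

theorem measure_exp_le (T : ℝ) (M : ℕ) (b : Fin d → ℕ) (i : Fin K)
    (hf : AEStronglyMeasurable (f i) PX) (l v : ℝ) (n : ℕ) :
    P {ω | ∃ t ≤ n, v ≤ l * binDeviation X Y T M b (⨍ x in binSet d M b, f i x ∂PX) i t ω -
      l ^ 2 / 8 * binCountArm X Y T M b i t ω} ≤ ENNReal.ofReal (Real.exp (-v)) := by
  have := h.isProb
  have hv := maximal_ineq_of_setLIntegral_le (P := P) (past X Y) past_mono h.past_le
    (expProcess X Y T M b (⨍ x in binSet d M b, f i x ∂PX) i l)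
    (measurable_expProcess T M b _ i l)
    (fun t E hE => h.setLIntegral_expProcess_le T M b i hf l t hE)
    (ENNReal.ofReal (Real.exp v)) n
  have h0 : ∫⁻ ω, expProcess X Y T M b (⨍ x in binSet d M b, f i x ∂PX) i l 0 ω ∂P = 1 := by
    simp [expProcess, deviation, pullCount]
  rw [h0] at hv
  rw [Real.exp_neg, ENNReal.ofReal_inv_of_pos (Real.exp_pos _)]
  refine le_trans ?_ (ENNReal.le_inv_iff_mul_le.2 ?_ : P {ω | ∃ t ≤ n, ENNReal.ofReal (Real.exp v) ≤
    expProcess X Y T M b (⨍ x in binSet d M b, f i x ∂PX) i l t ω} ≤ _)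
  · refine measure_mono fun ω ⟨t, ht, hle⟩ => ⟨t, ht, ?_⟩
    exact ENNReal.ofReal_le_ofReal (Real.exp_le_exp.2 hle)
  · rw [mul_comm]; exact hv

/-- The probability that the average of arm `i` deviates much after a number of pulls in
`[s, 2s)`. -/
theorem measure_levelFails_le {T : ℝ} (hT : 0 < T) (M : ℕ) (b : Fin d → ℕ) (i : Fin K)
    (hf : AEStronglyMeasurable (f i) PX) {s : ℕ} (hs : 1 ≤ s) (n : ℕ) :
    P {ω | ∃ m, s ≤ m ∧ m < 2 * s ∧ LevelFails T (fun u => binIndex M (X u ω) = b)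
      (fun u i => Y u i ω) (⨍ x in binSet d M b, f i x ∂PX) i m n} ≤
      ENNReal.ofReal (4 * s / T) := by
  set c := ⨍ x in binSet d M b, f i x ∂PX with hc
  set U := confRadius (s + 1) T
  set v := max (Real.log (T / (s + 1))) 1 with hv
  -- The logarithm in the radius is calibrated to give a probability proportional to `s / T`.
  have hexp : Real.exp (-v) ≤ 2 * s / T := by
    have hs' : (1 : ℝ) ≤ s := by exact_mod_cast hs
    calc Real.exp (-v) ≤ Real.exp (-Real.log (T / (s + 1))) := by
          gcongr; exact le_max_left _ _
      _ = (s + 1) / T := by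
          rw [← Real.log_inv, Real.exp_log (by positivity), inv_div]
      _ ≤ 2 * s / T := by gcongr; linarith
  calc _ ≤ P ({ω | ∃ t ≤ n, v ≤ U * binDeviation X Y T M b c i t ω -
        U ^ 2 / 8 * binCountArm X Y T M b i t ω} ∪
      {ω | ∃ t ≤ n, v ≤ (-U) * binDeviation X Y T M b c i t ω -
        (-U) ^ 2 / 8 * binCountArm X Y T M b i t ω}) := by
        refine measure_mono fun ω ⟨m, hsm, hm, t, ht, hN, hD⟩ => ?_
        rcases lt_abs.1 hD with hD | hD
        · left
          refine ⟨t, ht, ?_⟩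
          have := level_exponent_le hT hs hsm hm hD
          unfold binCountArm binDeviation
          rw [hN]
          exact this
        · right
          refine ⟨t, ht, ?_⟩
          have := level_exponent_le hT hs hsm hm hD
          unfold binCountArm binDeviation
          rw [hN, neg_sq, neg_mul_comm]
          exact this
    _ ≤ ENNReal.ofReal (Real.exp (-v)) + ENNReal.ofReal (Real.exp (-v)) :=
        (measure_union_le _ _).trans (add_le_add (h.measure_exp_le T M b i hf _ _ _)
          (h.measure_exp_le T M b i hf _ _ _))
    _ = ENNReal.ofReal (Real.exp (-v) + Real.exp (-v)) :=
        (ENNReal.ofReal_add (by positivity) (by positivity)).symm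
    _ ≤ _ := by
        refine ENNReal.ofReal_le_ofReal ?_
        calc _ ≤ 2 * s / T + 2 * s / T := add_le_add hexp hexp
          _ = _ := by ring

end IsMachine

end Machine

/-! ### Largest and second largest value -/

section Values

variable {K : ℕ}

theorem le_topValue (v : Fin K → ℝ) (i : Fin K) : v i ≤ topValue v :=
  le_ciSup (Set.finite_range v).bddAbove i

theorem exists_eq_topValue [NeZero K] (v : Fin K → ℝ) : ∃ j, v j = topValue v :=
  exists_eq_ciSup_of_finite

theorem topValue_le [NeZero K] {v : Fin K → ℝ} {c : ℝ} (h : ∀ i, v i ≤ c) : topValue v ≤ c :=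
  ciSup_le h

/-- This is the link to the margin condition: one suboptimal arm places the point in the margin
region at the level of its regret. -/
theorem topValue_sub_secondValue_le {v : Fin K → ℝ} {i : Fin K} (h : v i < topValue v) :
    0 < topValue v - secondValue v ∧ topValue v - secondValue v ≤ topValue v - v i := by
  have hi : i ∈ Finset.univ.filter (fun i => v i < topValue v) := by simpa using h
  have hne : (Finset.univ.filter (fun i => v i < topValue v)).Nonempty := ⟨i, hi⟩
  unfold secondValue
  rw [dif_pos hne]
  refine ⟨?_, sub_le_sub_left (Finset.le_sup' v hi) _⟩
  rw [sub_pos, Finset.sup'_lt_iff]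
  intro j hj
  simpa using hj

end Values

/-! ### Volume and diameter of a bin -/

section Geometry

variable {d : ℕ}

theorem measurableSet_cube (d : ℕ) : MeasurableSet (cube d) := by
  have : cube d = ⋂ l, ({x : Pt d | 0 ≤ x l} ∩ {x : Pt d | x l ≤ 1}) := by
    ext x; simp [cube]
  rw [this]
  refine MeasurableSet.iInter fun l => MeasurableSet.inter ?_ ?_
  · exact measurableSet_le measurable_const (by fun_prop)
  · exact measurableSet_le (by fun_prop) measurable_const

theorem volume_preimage_pi (d : ℕ) {s : Fin d → Set ℝ} (hs : ∀ l, MeasurableSet (s l)) :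
    volume {x : Pt d | ∀ l, x l ∈ s l} = ∏ l, volume (s l) := by
  have h := (PiLp.volume_preserving_ofLp (Fin d)).measure_preimage
    (MeasurableSet.univ_pi hs).nullMeasurableSet
  rw [volume_pi_pi] at h
  rw [← h]
  congr 1
  ext x
  simp

/-- Within the cube, a bin lies in the closed cube of side `1/M`, and for admissible indices
contains the open one, so the attribution of faces does not affect its volume. -/
theorem volume_bin_le {M : ℕ} (hM : 0 < M) (b : Fin d → ℕ) :
    volume (binSet d M b ∩ cube d) ≤ ENNReal.ofReal (1 / (M : ℝ) ^ d) := by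
  have hM' : (0 : ℝ) < M := by exact_mod_cast hM
  calc volume (binSet d M b ∩ cube d)
      ≤ volume {x : Pt d | ∀ l, x l ∈ Set.Icc ((b l : ℝ) / M) (((b l : ℝ) + 1) / M)} := by
        refine measure_mono fun x ⟨hb, hx⟩ l => ?_
        have h := (binIndex_spec hM hx l).2
        rw [mem_binSet.1 hb] at h
        exact h
    _ = ENNReal.ofReal (1 / (M : ℝ) ^ d) := by
        rw [volume_preimage_pi d fun l => measurableSet_Icc]
        simp only [Real.volume_Icc]
        have : ∀ l, ((b l : ℝ) + 1) / M - b l / M = 1 / M := fun l => by ring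
        simp only [this, Finset.prod_const, Finset.card_univ, Fintype.card_fin]
        rw [← ENNReal.ofReal_pow (by positivity), div_pow, one_pow]

theorem le_volume_bin {M : ℕ} (hM : 0 < M) {b : Fin d → ℕ} (hb : ∀ l, b l < M) :
    ENNReal.ofReal (1 / (M : ℝ) ^ d) ≤ volume (binSet d M b ∩ cube d) := by
  have hM' : (0 : ℝ) < M := by exact_mod_cast hM
  calc ENNReal.ofReal (1 / (M : ℝ) ^ d)
      = volume {x : Pt d | ∀ l, x l ∈ Set.Ioo ((b l : ℝ) / M) (((b l : ℝ) + 1) / M)} := by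
        rw [volume_preimage_pi d fun l => measurableSet_Ioo]
        simp only [Real.volume_Ioo]
        have : ∀ l, ((b l : ℝ) + 1) / M - b l / M = 1 / M := fun l => by ring
        simp only [this, Finset.prod_const, Finset.card_univ, Fintype.card_fin]
        rw [← ENNReal.ofReal_pow (by positivity), div_pow, one_pow]
    _ ≤ _ := by
        refine measure_mono fun x hx => ⟨?_, fun l => ?_⟩
        · rw [mem_binSet]
          funext l
          obtain ⟨h1, h2⟩ := hx l
          rw [div_lt_iff₀ hM'] at h1
          rw [lt_div_iff₀ hM'] at h2
          have : ⌊(M : ℝ) * x l⌋₊ = b l := by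
            rw [Nat.floor_eq_iff (by nlinarith [(Nat.cast_nonneg (b l) : (0 : ℝ) ≤ b l)])]
            constructor <;> linarith
          have := hb l
          unfold binIndex
          omega
        · obtain ⟨h1, h2⟩ := hx l
          have h3 : (0 : ℝ) ≤ (b l : ℝ) / M := by positivity
          have h4 : ((b l : ℝ) + 1) / M ≤ 1 := by
            rw [div_le_one hM']; exact_mod_cast hb l
          constructor <;> linarith

theorem norm_sub_le_of_bin {M : ℕ} (hM : 0 < M) {x x' : Pt d} (hx : x ∈ cube d)
    (hx' : x' ∈ cube d) (h : binIndex M x = binIndex M x') : ‖x - x'‖ ≤ √d / M := by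
  have hM' : (0 : ℝ) < M := by exact_mod_cast hM
  have hl : ∀ l, ‖(x - x') l‖ ^ 2 ≤ (1 / (M : ℝ)) ^ 2 := by
    intro l
    have h1 := (binIndex_spec hM hx l).2
    have h2 := (binIndex_spec hM hx' l).2
    rw [h] at h1
    rw [add_div] at h1 h2
    rw [Real.norm_eq_abs, sq_abs, ← sq_abs (1 / (M : ℝ)), ← sq_abs ((x - x') l)]
    have : |(x - x') l| ≤ |1 / (M : ℝ)| := by
      rw [abs_of_pos (show (0 : ℝ) < 1 / M by positivity)]
      have e : (x - x') l = x l - x' l := rfl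
      rw [e, abs_le]
      constructor <;> linarith
    gcongr
  rw [EuclideanSpace.norm_eq]
  calc √(∑ l, ‖(x - x') l‖ ^ 2) ≤ √(∑ _l : Fin d, (1 / (M : ℝ)) ^ 2) := by
        exact Real.sqrt_le_sqrt (Finset.sum_le_sum fun l _ => hl l)
    _ = √d / M := by
        rw [Finset.sum_const, Finset.card_univ, Fintype.card_fin, nsmul_eq_mul,
          Real.sqrt_mul (by positivity), Real.sqrt_sq (by positivity)]
        ring

end Geometry

/-! ### Consequences of the density, smoothness and margin conditions -/

section Density

variable {d K : ℕ} {PX : Measure (Pt d)} {cl cu : ℝ}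

theorem DensityCondition.absolutelyContinuous (h : DensityCondition PX cl cu) :
    PX ≪ volume.restrict (cube d) := by
  obtain ⟨p, _, _, rfl⟩ := h
  exact withDensity_absolutelyContinuous _ _

theorem DensityCondition.ae_mem_cube (h : DensityCondition PX cl cu) : ∀ᵐ x ∂PX, x ∈ cube d :=
  h.absolutelyContinuous (ae_restrict_mem (measurableSet_cube d))

theorem DensityCondition.apply (h : DensityCondition PX cl cu) {B : Set (Pt d)}
    (hB : MeasurableSet B) :
    ENNReal.ofReal cl * volume (B ∩ cube d) ≤ PX B ∧
      PX B ≤ ENNReal.ofReal cu * volume (B ∩ cube d) := by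
  obtain ⟨p, hp, hpb, rfl⟩ := h
  have hm := hB.inter (measurableSet_cube d)
  rw [withDensity_apply _ hB, Measure.restrict_restrict hB]
  constructor
  · rw [← setLIntegral_const]
    exact setLIntegral_mono' hm fun x hx => ENNReal.ofReal_le_ofReal (hpb x hx.2).1
  · rw [← setLIntegral_const]
    exact setLIntegral_mono' hm fun x hx => ENNReal.ofReal_le_ofReal (hpb x hx.2).2

theorem DensityCondition.bin_le [IsFiniteMeasure PX] (h : DensityCondition PX cl cu) (hcu : 0 ≤ cu)
    {M : ℕ} (hM : 0 < M) (b : Fin d → ℕ) : PX.real (binSet d M b) ≤ cu / (M : ℝ) ^ d := by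
  refine ENNReal.toReal_le_of_le_ofReal (by positivity) ?_
  refine (h.apply (measurableSet_binSet M b)).2.trans ?_
  rw [div_eq_mul_one_div, ENNReal.ofReal_mul hcu]
  gcongr
  exact volume_bin_le hM b

theorem DensityCondition.le_bin [IsFiniteMeasure PX] (h : DensityCondition PX cl cu) (hcl : 0 ≤ cl)
    {M : ℕ} (hM : 0 < M) {b : Fin d → ℕ} (hb : ∀ l, b l < M) :
    cl / (M : ℝ) ^ d ≤ PX.real (binSet d M b) := by
  refine (ENNReal.ofReal_le_iff_le_toReal (measure_ne_top _ _)).1 ?_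
  refine le_trans ?_ (h.apply (measurableSet_binSet M b)).1
  rw [div_eq_mul_one_div, ENNReal.ofReal_mul hcl]
  gcongr
  exact le_volume_bin hM hb

variable {f : Fin K → Pt d → ℝ} {β L : ℝ}

theorem SmoothnessCondition.continuousOn (h : SmoothnessCondition f β L) (hβ : 0 < β) (i : Fin K) :
    ContinuousOn (f i) (cube d) := by
  intro x hx
  rw [ContinuousWithinAt, tendsto_iff_norm_sub_tendsto_zero]
  have h1 : Filter.Tendsto (fun x' => L * ‖x' - x‖ ^ β) (nhdsWithin x (cube d)) (nhds 0) := by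
    have : ContinuousAt (fun x' => L * ‖x' - x‖ ^ β) x := by
      refine continuousAt_const.mul (ContinuousAt.rpow_const (by fun_prop) (Or.inr hβ.le))
    have h2 := this.continuousWithinAt (s := cube d)
    rw [ContinuousWithinAt] at h2
    simpa [Real.zero_rpow hβ.ne'] using h2
  refine squeeze_zero' (Filter.Eventually.of_forall fun _ => norm_nonneg _) ?_ h1
  filter_upwards [self_mem_nhdsWithin] with x' hx'
  exact h i x' hx' x hx

/-- A machine does not include measurability of `f i`; it comes from continuity on the cube, which
carries `PX`. -/
theorem SmoothnessCondition.aestronglyMeasurable (h : SmoothnessCondition f β L) (hβ : 0 < β)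
    (hd : DensityCondition PX cl cu) (i : Fin K) : AEStronglyMeasurable (f i) PX :=
  ((h.continuousOn hβ i).aestronglyMeasurable (measurableSet_cube d)).mono_ac
    hd.absolutelyContinuous

/-- The oscillation of the mean reward functions in a bin of side `1/M`. -/
def oscillation (d M : ℕ) (β L : ℝ) : ℝ := L * (√d / M) ^ β

theorem SmoothnessCondition.abs_sub_le (h : SmoothnessCondition f β L) (hβ : 0 < β) (hL : 0 < L)
    {M : ℕ} (hM : 0 < M) {x x' : Pt d} (hx : x ∈ cube d) (hx' : x' ∈ cube d)
    (hb : binIndex M x = binIndex M x') (i : Fin K) :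
    |f i x - f i x'| ≤ oscillation d M β L := by
  refine (h i x hx x' hx').trans ?_
  unfold oscillation
  gcongr
  exact norm_sub_le_of_bin hM hx hx' hb

variable {α δ₀ C₀ : ℝ}

/-- Beyond `δ₀` the trivial bound `1 ≤ (δ/δ₀)^α` takes over, so no later estimate has to restrict
`δ`. -/
theorem MarginCondition.le_of_nonneg [IsProbabilityMeasure PX] (h : MarginCondition PX f α δ₀ C₀)
    (hα : 0 < α) (hδ₀ : 0 < δ₀) (hC₀ : 0 < C₀) {δ : ℝ} (hδ : 0 ≤ δ) :
    PX.real {x | 0 < topValue (fun i => f i x) - secondValue (fun i => f i x) ∧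
      topValue (fun i => f i x) - secondValue (fun i => f i x) ≤ δ} ≤
      (C₀ + (δ₀ ^ α)⁻¹) * δ ^ α := by
  have h0 : 0 < δ₀ ^ α := Real.rpow_pos_of_pos hδ₀ α
  have h1 : 0 ≤ δ ^ α := Real.rpow_nonneg hδ α
  rcases le_total δ δ₀ with hle | hle
  · refine (h δ hδ hle).trans ?_
    gcongr
    linarith [inv_pos.2 h0]
  · refine measureReal_le_one.trans ?_
    have h2 : δ₀ ^ α ≤ δ ^ α := Real.rpow_le_rpow hδ₀.le hle hα.le
    calc (1 : ℝ) = (δ₀ ^ α)⁻¹ * δ₀ ^ α := (inv_mul_cancel₀ h0.ne').symm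
      _ ≤ (C₀ + (δ₀ ^ α)⁻¹) * δ ^ α := by
        gcongr
        linarith

end Density

/-! ### Pointwise regret against the gap of bin averages -/

section BinMeans

variable {d K : ℕ} {PX : Measure (Pt d)} {cl cu : ℝ} {f : Fin K → Pt d → ℝ} {β L : ℝ}

/-- The average of the mean reward of arm `i` in the bin `b`. -/
def binMean (PX : Measure (Pt d)) (f : Fin K → Pt d → ℝ) (M : ℕ) (b : Fin d → ℕ) (i : Fin K) : ℝ :=
  ⨍ x in binSet d M b, f i x ∂PX

/-- The gap between arm `i` and the best arm on average in the bin `b`. -/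
def binGap (PX : Measure (Pt d)) (f : Fin K → Pt d → ℝ) (M : ℕ) (b : Fin d → ℕ) (i : Fin K) : ℝ :=
  topValue (binMean PX f M b) - binMean PX f M b i

variable [IsProbabilityMeasure PX]

theorem DensityCondition.integrable (hd : DensityCondition PX cl cu)
    (hs : SmoothnessCondition f β L) (hβ : 0 < β)
    (hf : ∀ i, ∀ x ∈ cube d, 0 ≤ f i x ∧ f i x ≤ 1) (i : Fin K) : Integrable (f i) PX :=
  Integrable.of_mem_Icc 0 1 (hs.aestronglyMeasurable hβ hd i).aemeasurable
    (hd.ae_mem_cube.mono fun x hx => hf i x hx)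

theorem DensityCondition.integrable_topValue [NeZero K] (hd : DensityCondition PX cl cu)
    (hs : SmoothnessCondition f β L) (hβ : 0 < β)
    (hf : ∀ i, ∀ x ∈ cube d, 0 ≤ f i x ∧ f i x ≤ 1) :
    Integrable (fun x => topValue (fun i => f i x)) PX := by
  have hint := hd.integrable hs hβ hf
  have hm : AEMeasurable (fun x => topValue (fun i => f i x)) PX := by
    have e : (fun x => topValue (fun i => f i x)) =
        Finset.univ.sup' Finset.univ_nonempty f := by
      ext x
      rw [Finset.sup'_apply, Finset.sup'_univ_eq_ciSup]
      rfl
    rw [e]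
    refine Finset.sup'_induction Finset.univ_nonempty f (p := fun g => AEMeasurable g PX)
      (fun a ha b hb => ha.sup hb) fun i _ => (hint i).aemeasurable
  refine Integrable.of_mem_Icc 0 1 hm (hd.ae_mem_cube.mono fun x hx => ?_)
  exact ⟨((hf 0 x hx).1).trans (le_topValue (fun i => f i x) 0), topValue_le fun i => (hf i x hx).2⟩

theorem DensityCondition.binMean_mem (hd : DensityCondition PX cl cu) {M : ℕ} {b : Fin d → ℕ}
    (hpos : PX (binSet d M b) ≠ 0) {i : Fin K} {u v : ℝ} (hint : Integrable (f i) PX)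
    (h : ∀ x ∈ cube d, binIndex M x = b → u ≤ f i x ∧ f i x ≤ v) :
    u ≤ binMean PX f M b i ∧ binMean PX f M b i ≤ v := by
  have := (convex_Icc u v).set_average_mem isClosed_Icc hpos (measure_ne_top _ _) (f := f i)
    (μ := PX) ?_ hint.integrableOn
  · exact this
  · rw [ae_restrict_iff' (measurableSet_binSet M b)]
    exact hd.ae_mem_cube.mono fun x hx hb => h x hx hb

variable (hd : DensityCondition PX cl cu) (hs : SmoothnessCondition f β L) (hβ : 0 < β)
  (hL : 0 < L) (hf : ∀ i, ∀ x ∈ cube d, 0 ≤ f i x ∧ f i x ≤ 1) {M : ℕ} (hM : 0 < M)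

include hd hs hβ hL hf hM

theorem abs_sub_binMean_le {x : Pt d} (hx : x ∈ cube d)
    (hpos : PX (binSet d M (binIndex M x)) ≠ 0) (i : Fin K) :
    |f i x - binMean PX f M (binIndex M x) i| ≤ oscillation d M β L := by
  have := hd.binMean_mem (u := f i x - oscillation d M β L) (v := f i x + oscillation d M β L)
    hpos (hd.integrable hs hβ hf i) ?_
  · rw [abs_le]; constructor <;> linarith
  · intro x' hx' hb
    have := abs_le.1 (hs.abs_sub_le hβ hL hM hx' hx hb i)
    constructor <;> linarith

variable [NeZero K]

/-- Passing from values at `x` to bin averages moves both the maximum and the value of arm `i` by at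
most one oscillation. -/
theorem regret_sub_binGap_le {x : Pt d} (hx : x ∈ cube d)
    (hpos : PX (binSet d M (binIndex M x)) ≠ 0) (i : Fin K) :
    |topValue (fun i => f i x) - f i x - binGap PX f M (binIndex M x) i| ≤
      2 * oscillation d M β L := by
  have h := fun i => abs_le.1 (abs_sub_binMean_le hd hs hβ hL hf hM hx hpos i)
  have h1 : topValue (fun i => f i x) ≤
      topValue (binMean PX f M (binIndex M x)) + oscillation d M β L :=
    topValue_le fun j => by
      have := le_topValue (binMean PX f M (binIndex M x)) j
      linarith [h j]
  have h2 : topValue (binMean PX f M (binIndex M x)) ≤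
      topValue (fun i => f i x) + oscillation d M β L :=
    topValue_le fun j => by
      have := le_topValue (fun i => f i x) j
      linarith [h j]
  unfold binGap
  rw [abs_le]
  constructor <;> linarith [h i]

/-- A bin that contains an arm of moderate gap lies in the region controlled by the margin
condition. -/
theorem card_bins_le (hcl : 0 < cl) {u : ℝ} (S : Finset (Fin d → ℕ))
    (hS : ∀ b ∈ S, (∀ l, b l < M) ∧ ∃ i : Fin K, 2 * oscillation d M β L < binGap PX f M b i ∧
      binGap PX f M b i ≤ 2 * u) :
    S.card * (cl / (M : ℝ) ^ d) ≤
      PX.real {x | 0 < topValue (fun i => f i x) - secondValue (fun i => f i x) ∧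
        topValue (fun i => f i x) - secondValue (fun i => f i x) ≤ 4 * u} := by
  have hM' : (0 : ℝ) < M := by exact_mod_cast hM
  calc S.card * (cl / (M : ℝ) ^ d) ≤ ∑ b ∈ S, PX.real (binSet d M b) := by
        rw [← nsmul_eq_mul]
        exact Finset.card_nsmul_le_sum _ _ _ fun b hb => hd.le_bin hcl.le hM (hS b hb).1
    _ = PX.real (⋃ b ∈ S, binSet d M b) := by
        rw [measureReal_biUnion_finset]
        · intro b _ b' _ hbb'
          exact Set.disjoint_left.2 fun x hx hx' => hbb' (hx.symm.trans hx')
        · exact fun b _ => measurableSet_binSet M b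
    _ ≤ _ := by
        refine ENNReal.toReal_mono (measure_ne_top _ _) (measure_mono_ae ?_)
        filter_upwards [hd.ae_mem_cube] with x hx hxb
        obtain ⟨b, hb, hxb⟩ := Set.mem_iUnion₂.1 hxb
        obtain rfl := mem_binSet.1 hxb
        obtain ⟨hbM, i, h1, h2⟩ := hS _ hb
        have hpos : PX (binSet d M (binIndex M x)) ≠ 0 := by
          intro h0
          have := hd.le_bin hcl.le hM hbM
          rw [Measure.real, h0, ENNReal.toReal_zero] at this
          exact this.not_gt (by positivity)
        -- A gap above `2ε` keeps arm `i` suboptimal at `x`, with regret at most `2u + 2ε < 4u`,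
        -- because `2ε < 2u`.
        have h3 := abs_le.1 (regret_sub_binGap_le hd hs hβ hL hf hM hx hpos i)
        have h4 := topValue_sub_secondValue_le (v := fun i => f i x) (i := i) (by linarith)
        exact ⟨h4.1, by linarith [h4.2]⟩

/-- The regret of an arm in a bin: small values are controlled by the margin region, large ones by
the gap of the arm. -/
theorem setIntegral_regret_le {V : Set (Pt d)} (hV : MeasurableSet V)
    (hsub : {x | 0 < topValue (fun i => f i x) - secondValue (fun i => f i x) ∧
      topValue (fun i => f i x) - secondValue (fun i => f i x) ≤ 4 * oscillation d M β L} ⊆ V)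
    (b : Fin d → ℕ) (i : Fin K) :
    ∫ x in binSet d M b, (topValue (fun i => f i x) - f i x) ∂PX ≤
      4 * oscillation d M β L * PX.real (V ∩ binSet d M b) +
        PX.real (binSet d M b) * (2 * if 2 * oscillation d M β L < binGap PX f M b i then
          binGap PX f M b i else 0) := by
  classical
  rcases eq_or_ne (PX (binSet d M b)) 0 with h0 | hpos
  · rw [setIntegral_measure_zero _ h0, Measure.real, Measure.real, h0,
      measure_mono_null Set.inter_subset_right h0]
    simp
  set ε := oscillation d M β L with hε
  have hε0 : 0 ≤ ε := by rw [hε]; unfold oscillation; positivity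
  set g := if 2 * ε < binGap PX f M b i then binGap PX f M b i else 0 with hg
  have hg0 : 0 ≤ g := by
    rw [hg]; split_ifs with h
    · linarith
    · exact le_rfl
  -- Split at `4ε`. Positive regret below it puts `x` in `V`; regret above it forces a gap above
  -- `2ε` and is at most gap plus `2ε`, hence below twice the gap.
  have hpt : ∀ x ∈ cube d, binIndex M x = b →
      topValue (fun i => f i x) - f i x ≤ V.indicator (fun _ => 4 * ε) x + 2 * g := by
    rintro x hx rfl
    have h3 := abs_le.1 (regret_sub_binGap_le hd hs hβ hL hf hM hx hpos i)
    have h5 : 0 ≤ V.indicator (fun _ => 4 * ε) x :=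
      Set.indicator_nonneg (fun _ _ => by positivity) _
    rcases le_or_gt (topValue (fun i => f i x) - f i x) (4 * ε) with hle | hgt
    · rcases (sub_nonneg.2 (le_topValue (fun i => f i x) i)).eq_or_lt with h | h
      · rw [← h]; positivity
      · have h4 := topValue_sub_secondValue_le (v := fun i => f i x) (i := i) (by linarith)
        rw [Set.indicator_of_mem (hsub ⟨h4.1, h4.2.trans hle⟩)]
        linarith
    · have : g = binGap PX f M (binIndex M x) i := by
        rw [hg]; exact if_pos (by linarith)
      linarith
  have hint1 : IntegrableOn (fun x => topValue (fun i => f i x) - f i x) (binSet d M b) PX :=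
    ((hd.integrable_topValue hs hβ hf).sub (hd.integrable hs hβ hf i)).integrableOn
  have hind : Integrable (V.indicator fun _ => 4 * ε) (PX.restrict (binSet d M b)) :=
    (integrable_const (4 * ε)).indicator hV
  calc ∫ x in binSet d M b, (topValue (fun i => f i x) - f i x) ∂PX
      ≤ ∫ x in binSet d M b, (V.indicator (fun _ => 4 * ε) x + 2 * g) ∂PX := by
        refine setIntegral_mono_on_ae hint1 (hind.add (integrable_const _))
          (measurableSet_binSet M b) ?_
        filter_upwards [hd.ae_mem_cube] with x hx hb
        exact hpt x hx hb
    _ = _ := by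
        rw [integral_add hind (integrable_const _), integral_indicator_const _ hV,
          integral_const, measureReal_restrict_apply hV, measureReal_restrict_apply_univ]
        simp only [smul_eq_mul]
        ring

end BinMeans

/-! ### Summing the radii over dyadic blocks -/

section Numeric

/-- A geometric sum is controlled by its largest term. -/
theorem sum_filter_rpow_le {p a y : ℝ} (hp : 0 < p) (ha : 0 < a) (hy : 0 ≤ y) (N : ℕ) :
    ∑ k ∈ (Finset.range N).filter (fun k : ℕ => 2 ^ k * a ≤ y), (2 ^ k * a) ^ p ≤
      (1 - 2 ^ (-p))⁻¹ * y ^ p := by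
  have hr : (2 : ℝ) ^ (-p) < 1 := Real.rpow_lt_one_of_one_lt_of_neg one_lt_two (by linarith)
  have hr0 : (0 : ℝ) < 2 ^ (-p) := by positivity
  set r : ℝ := 2 ^ (-p) with hrdef
  set x : ℕ → ℝ := fun k => (2 ^ k * a) ^ p with hx
  have hx0 : ∀ k, 0 < x k := fun k => by simp only [hx]; positivity
  have hstep : ∀ k, x k = r * x (k + 1) := by
    intro k
    simp only [hx, hrdef]
    rw [Real.rpow_neg two_pos.le, ← Real.inv_rpow two_pos.le, ← Real.mul_rpow (by positivity)
      (by positivity)]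
    congr 1
    rw [pow_succ]
    ring
  -- The bound `r * x N` makes the induction telescope: adding `(1 - r) * x N` gives `x N`, which is
  -- at most `y ^ p` for an admitted term.
  have key : ∀ N, ∑ k ∈ Finset.range N, (if 2 ^ k * a ≤ y then (1 - r) * x k else 0) ≤
      min (r * x N) (y ^ p) := by
    intro N
    induction N with
    | zero => simp only [Finset.range_zero, Finset.sum_empty]; have := hx0 0; positivity
    | succ N ih =>
      rw [Finset.sum_range_succ, ← hstep]
      have h1 := ih.trans (min_le_left _ _)
      have h2 := ih.trans (min_le_right _ _)
      have h0 := hx0 N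
      split_ifs with h
      · have : x N ≤ y ^ p := Real.rpow_le_rpow (by positivity) h hp.le
        refine le_min ?_ ?_ <;> linarith
      · refine le_min ?_ ?_ <;> nlinarith
  rw [Finset.sum_filter, inv_mul_eq_div, le_div_iff₀ (by linarith), Finset.sum_mul]
  refine le_trans (le_of_eq ?_) ((key N).trans (min_le_right _ _))
  refine Finset.sum_congr rfl fun k _ => ?_
  split_ifs <;> simp [hx, mul_comm]

/-- The dependence on `x` is traded for a small negative power, by `-log x ≤ x^(-η)/η`, so that a
geometric sum can absorb it. -/
theorem max_log_div_le {η ρ x c lam : ℝ} (hη : 0 < η) (hρ : 0 < ρ) (hx : 0 < x)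
    (hlam : 1 / 2 ≤ lam) (hc : 0 ≤ c) (h : Real.log ρ ≤ c * lam) :
    max (Real.log (ρ / x)) 1 ≤ (c + 2 + 2 / η) * lam * (1 + x ^ (-η)) := by
  have hxη : 0 < x ^ (-η) := Real.rpow_pos_of_pos hx _
  have h1 : -Real.log x ≤ x ^ (-η) / η := by
    rw [← Real.log_inv, Real.rpow_neg hx.le, ← Real.inv_rpow hx.le]
    exact Real.log_le_rpow_div (by positivity) hη
  have h2 : x ^ (-η) / η ≤ 2 / η * lam * x ^ (-η) := by
    rw [div_mul_eq_mul_div, div_mul_eq_mul_div]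
    gcongr
    nlinarith
  have h3 : 0 ≤ c * lam * x ^ (-η) := by positivity
  have h4 : 0 ≤ 2 / η * lam := by positivity
  have h5 : 0 ≤ lam * x ^ (-η) := by positivity
  have h6 : 0 ≤ c * lam := by positivity
  have h7 : 0 ≤ 2 / η * lam * x ^ (-η) := by positivity
  refine max_le ?_ ?_
  · rw [Real.log_div hρ.ne' hx.ne']
    nlinarith
  · nlinarith

/-- Put `x = 2^k a`; then `T / 2^k = T a / x`, so `T` enters only through `log (T a)`. With `p =
(1-α)/2` and `q = (1+α)/2`, a term is at most a multiple of `a^(-p) lam^q (x^p + x^(p/2))`. As `α <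
1`, both exponents of `x` are positive, so the last terms dominate; the filter forces `x` to be
`O(lam)`, and `lam^q lam^p = lam`. -/
theorem sum_confRadius_le {α c c₁ : ℝ} (hα : 0 < α) (hα1 : α < 1) (hc : 0 < c) (hc₁ : 0 ≤ c₁) :
    ∃ C : ℝ, 0 < C ∧ ∀ T a lam : ℝ, 0 < T → 0 < a → 1 / 2 ≤ lam → Real.log (T * a) ≤ c₁ * lam →
      ∀ N : ℕ, ∑ k ∈ (Finset.range N).filter
        (fun k : ℕ => c ^ 2 * a < confRadius (2 ^ k) T ^ 2), 2 ^ k * confRadius (2 ^ k) T ^ (1 + α) ≤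
        C * lam * a ^ (-((1 - α) / 2)) := by
  set p := (1 - α) / 2 with hp
  set q := (1 + α) / 2 with hq
  have hp0 : 0 < p := by rw [hp]; linarith
  have hq0 : 0 < q := by rw [hq]; linarith
  have hq1 : q ≤ 1 := by rw [hq]; linarith
  have hpq : p + q = 1 := by rw [hp, hq]; ring
  -- The constant of `max_log_div_le` for `η = p/2`, a value that leaves the positive exponent `p -
  -- η = p/2`.
  set c₂ := c₁ + 2 + 2 / (p / 2) with hc₂
  have hc₂0 : 0 < c₂ := by positivity
  -- The quotient solves the filter condition for `x ≥ 1`; the summand `2` ensures `c₃ * lam ≥ 1`,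
  -- which covers `x ≤ 1` and orders the powers `p/2` and `p`.
  set c₃ := 16 * c₂ / c ^ 2 + 2 with hc₃
  have hc₃2 : 2 ≤ c₃ := by rw [hc₃]; linarith [show 0 < 16 * c₂ / c ^ 2 by positivity]
  have hG : ∀ p : ℝ, 0 < p → 0 < (1 - (2 : ℝ) ^ (-p))⁻¹ := fun p hp => by
    have : (2 : ℝ) ^ (-p) < 1 := Real.rpow_lt_one_of_one_lt_of_neg one_lt_two (by linarith)
    exact inv_pos.2 (by linarith)
  have hG1 := hG p hp0
  have hG2 := hG (p / 2) (by positivity)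
  set G₁ := (1 - (2 : ℝ) ^ (-p))⁻¹
  set G₂ := (1 - (2 : ℝ) ^ (-(p / 2)))⁻¹
  refine ⟨(8 * c₂) ^ q * c₃ ^ p * (G₁ + G₂), by positivity, ?_⟩
  intro T a lam hT ha hlam hlog N
  have hlam0 : 0 < lam := by linarith
  have hy1 : 1 ≤ c₃ * lam := by nlinarith
  have hell : ∀ k : ℕ, max (Real.log (T / (2 ^ k : ℕ))) 1 ≤
      c₂ * lam * (1 + (2 ^ k * a) ^ (-(p / 2))) := by
    intro k
    have := max_log_div_le (η := p / 2) (x := 2 ^ k * a) (by positivity) (mul_pos hT ha)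
      (by positivity) hlam hc₁ hlog
    rw [mul_div_mul_right _ _ ha.ne'] at this
    push_cast
    exact this
  have hterm : ∀ k : ℕ, 2 ^ k * confRadius (2 ^ k) T ^ (1 + α) ≤
      a ^ (-p) * (8 * c₂ * lam) ^ q * ((2 ^ k * a) ^ p + (2 ^ k * a) ^ (p / 2)) := by
    intro k
    set x := 2 ^ k * a with hx
    have hx0 : 0 < x := by positivity
    have hU : confRadius (2 ^ k) T ^ (1 + α) = (confRadius (2 ^ k) T ^ 2) ^ q := by
      rw [← Real.rpow_natCast, ← Real.rpow_mul (confRadius_nonneg _ _)]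
      congr 1
      rw [hq]; push_cast; ring
    have hxη : 0 < x ^ (-(p / 2)) := Real.rpow_pos_of_pos hx0 _
    have hU2 : confRadius (2 ^ k) T ^ 2 ≤ (a / x) * (8 * c₂ * lam * (1 + x ^ (-(p / 2)))) := by
      rw [sq_confRadius]
      have e : (a / x) = 1 / (2 ^ k : ℕ) := by
        rw [hx]; push_cast; field_simp
      rw [e, one_div, mul_comm, ← div_eq_inv_mul]
      have := hell k
      rw [← hx] at this
      refine div_le_div_of_nonneg_right ?_ (by positivity)
      linarith
    have e2 : (2 : ℝ) ^ k = x / a := by rw [hx]; field_simp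
    have h1 : (1 + x ^ (-(p / 2))) ^ q ≤ 1 + x ^ (-(p / 2)) := by
      calc (1 + x ^ (-(p / 2))) ^ q ≤ (1 + x ^ (-(p / 2))) ^ (1 : ℝ) :=
            Real.rpow_le_rpow_of_exponent_le (by linarith) hq1
        _ = _ := Real.rpow_one _
    rw [hU, e2]
    calc x / a * (confRadius (2 ^ k) T ^ 2) ^ q
        ≤ x / a * ((a / x) * (8 * c₂ * lam * (1 + x ^ (-(p / 2))))) ^ q := by gcongr
      _ = x / a * ((a / x) ^ q * ((8 * c₂ * lam) ^ q * (1 + x ^ (-(p / 2))) ^ q)) := by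
          rw [Real.mul_rpow (by positivity) (by positivity),
            Real.mul_rpow (by positivity) (by positivity)]
      _ ≤ x / a * ((a / x) ^ q * ((8 * c₂ * lam) ^ q * (1 + x ^ (-(p / 2))))) := by gcongr
      _ = (x / a * (a / x) ^ q) * ((8 * c₂ * lam) ^ q * (1 + x ^ (-(p / 2)))) := by ring
      _ = (a ^ (-p) * x ^ p) * ((8 * c₂ * lam) ^ q * (1 + x ^ (-(p / 2)))) := by
          congr 1
          have : (a / x) ^ q = (x / a) ^ (-q) := by
            rw [Real.rpow_neg (by positivity), ← Real.inv_rpow (by positivity), inv_div]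
          rw [this]
          nth_rewrite 1 [← Real.rpow_one (x / a)]
          rw [← Real.rpow_add (by positivity), show 1 + -q = p by linarith,
            Real.div_rpow hx0.le ha.le, Real.rpow_neg ha.le]
          ring
      _ = a ^ (-p) * (8 * c₂ * lam) ^ q * (x ^ p + x ^ p * x ^ (-(p / 2))) := by ring
      _ = _ := by
          rw [← Real.rpow_add hx0]
          congr 3
          ring
  have hsub : (Finset.range N).filter (fun k : ℕ => c ^ 2 * a < confRadius (2 ^ k) T ^ 2) ⊆
      (Finset.range N).filter (fun k : ℕ => 2 ^ k * a ≤ c₃ * lam) := by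
    intro k hk
    rw [Finset.mem_filter] at hk ⊢
    refine ⟨hk.1, ?_⟩
    have h1 := hk.2
    have h2 := hell k
    set x := 2 ^ k * a with hx
    rcases le_total x 1 with hle | hge
    · linarith
    have hx1 : x ^ (-(p / 2)) ≤ 1 := Real.rpow_le_one_of_one_le_of_nonpos hge (by linarith)
    rw [sq_confRadius, lt_div_iff₀ (by positivity)] at h1
    push_cast at h1
    have h3 : c ^ 2 * x < 16 * c₂ * lam := by
      have : c₂ * lam * (1 + x ^ (-(p / 2))) ≤ c₂ * lam * 2 := by gcongr; linarith
      push_cast at h2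
      rw [hx]
      linarith
    have h4 : x ≤ 16 * c₂ / c ^ 2 * lam := by
      rw [div_mul_eq_mul_div, le_div_iff₀ (by positivity)]
      linarith
    rw [hc₃]
    linarith
  calc ∑ k ∈ (Finset.range N).filter
        (fun k : ℕ => c ^ 2 * a < confRadius (2 ^ k) T ^ 2), 2 ^ k * confRadius (2 ^ k) T ^ (1 + α)
      ≤ ∑ k ∈ (Finset.range N).filter (fun k : ℕ => 2 ^ k * a ≤ c₃ * lam),
          2 ^ k * confRadius (2 ^ k) T ^ (1 + α) :=
        Finset.sum_le_sum_of_subset_of_nonneg hsub fun k _ _ =>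
          mul_nonneg (by positivity) (Real.rpow_nonneg (confRadius_nonneg _ _) _)
    _ ≤ ∑ k ∈ (Finset.range N).filter (fun k : ℕ => 2 ^ k * a ≤ c₃ * lam),
          a ^ (-p) * (8 * c₂ * lam) ^ q * ((2 ^ k * a) ^ p + (2 ^ k * a) ^ (p / 2)) :=
        Finset.sum_le_sum fun k _ => hterm k
    _ = a ^ (-p) * (8 * c₂ * lam) ^ q *
        (∑ k ∈ (Finset.range N).filter (fun k : ℕ => 2 ^ k * a ≤ c₃ * lam), (2 ^ k * a) ^ p +
          ∑ k ∈ (Finset.range N).filter (fun k : ℕ => 2 ^ k * a ≤ c₃ * lam),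
            (2 ^ k * a) ^ (p / 2)) := by
        rw [← Finset.mul_sum, Finset.sum_add_distrib]
    _ ≤ a ^ (-p) * (8 * c₂ * lam) ^ q * (G₁ * (c₃ * lam) ^ p + G₂ * (c₃ * lam) ^ p) := by
        have h1 := sum_filter_rpow_le hp0 ha (show 0 ≤ c₃ * lam by linarith) N
        have h2 := sum_filter_rpow_le (p := p / 2) (by positivity) ha
          (show 0 ≤ c₃ * lam by linarith) N
        have h3 : (c₃ * lam) ^ (p / 2) ≤ (c₃ * lam) ^ p :=
          Real.rpow_le_rpow_of_exponent_le hy1 (by linarith)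
        gcongr
        exact h2.trans (by gcongr)
    _ = (8 * c₂) ^ q * c₃ ^ p * (G₁ + G₂) * lam * a ^ (-p) := by
        rw [Real.mul_rpow (by positivity) hlam0.le, Real.mul_rpow (by positivity) hlam0.le]
        have : lam ^ q * lam ^ p = lam := by
          rw [← Real.rpow_add hlam0, add_comm, hpq, Real.rpow_one]
        calc _ = (8 * c₂) ^ q * c₃ ^ p * (G₁ + G₂) * (lam ^ q * lam ^ p) * a ^ (-p) := by ring
          _ = _ := by rw [this]

end Numeric

/-! ### Cost of one bin in dyadic blocks -/

section PerBin

variable {d K : ℕ} [NeZero K] {Ω : Type*} {X : ℕ → Ω → Pt d} {Y : ℕ → Fin K → Ω → ℝ}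

/-- This decouples the bins: `binState` is defined by a recursion that never mentions the other bins
or the global history. -/
theorem binnedSE_history (T : ℝ) (M : ℕ) (b : Fin d → ℕ) (t : ℕ) (ω : Ω) :
    seState 1 T (((history (binnedSE M 1 T) X Y t ω).filter (fun o => binIndex M o.1 = b)).map
      (fun o => o.2.2)) = binState X Y T M b t ω := by
  induction t with
  | zero => rfl
  | succ t ih =>
    simp only [history, pathState, binState, List.filter_cons, decide_eq_true_eq]
    by_cases hb : binIndex M (X t ω) = b
    · subst hb
      simp only [if_true, List.map_cons, seState]
      rw [ih, show binnedSE M 1 T (history (binnedSE M 1 T) X Y t ω) (X t ω) =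
        (binState X Y T M (binIndex M (X t ω)) t ω).arm from congrArg SEState.arm ih]
    · simp only [hb, if_false]
      exact ih

theorem binnedSE_apply (T : ℝ) (M : ℕ) (t : ℕ) (ω : Ω) (x : Pt d) :
    binnedSE M 1 T (history (binnedSE M 1 T) X Y t ω) x =
      (binState X Y T M (binIndex M x) t ω).arm :=
  congrArg SEState.arm (binnedSE_history T M (binIndex M x) t ω)

theorem round_le (T : ℝ) (s : ℕ → Prop) [DecidablePred s] (y : ℕ → Fin K → ℝ) (t : ℕ) :
    (pathState T s y t).round ≤ t + 1 := by
  have h : ∀ i t, pullCount T s y i t ≤ t := by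
    intro i t
    induction t with
    | zero => rfl
    | succ t ih => simp only [pullCount]; split_ifs <;> omega
  rw [round_eq_pullCount_arm]
  exact Nat.succ_le_succ (h _ t)

/-- A level in `[2^k, 2^(k+1))` fails for some arm before time `n` in the bin `b`. -/
def blockFails (X : ℕ → Ω → Pt d) (Y : ℕ → Fin K → Ω → ℝ) (μ : Fin K → ℝ) (T : ℝ) (M : ℕ)
    (b : Fin d → ℕ) (n k : ℕ) : Set Ω :=
  ⋃ i, {ω | ∃ m, 2 ^ k ≤ m ∧ m < 2 * 2 ^ k ∧ LevelFails T (fun u => binIndex M (X u ω) = b)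
      (fun u i => Y u i ω) (μ i) i m n}

/-- The round in progress in the bin `b` at time `t` has its index in `[2^k, 2^(k+1))`. -/
def roundBlock (X : ℕ → Ω → Pt d) (Y : ℕ → Fin K → Ω → ℝ) (T : ℝ) (M : ℕ)
    (b : Fin d → ℕ) (t k : ℕ) : Set Ω :=
  {ω | 2 ^ k ≤ (binState X Y T M b t ω).round ∧ (binState X Y T M b t ω).round < 2 * 2 ^ k}

/-- The gap of the arm chosen in a bin, split according to dyadic blocks of rounds. -/
theorem gap_arm_le_sum {T : ℝ} (hT : 0 < T) {μ : Fin K → ℝ} (hμ : ∀ i, 0 ≤ μ i ∧ μ i ≤ 1)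
    (M : ℕ) (b : Fin d → ℕ) {n t : ℕ} (ht : t < n) {e : ℝ} (he : 0 ≤ e) (ω : Ω)
    {F : ℕ → Set Ω} (hF : ∀ k, blockFails X Y μ T M b n k ⊆ F k) :
    (if 2 * e < topValue μ - μ (binState X Y T M b t ω).arm then
      topValue μ - μ (binState X Y T M b t ω).arm else 0) ≤
    ∑ k ∈ (Finset.range (n + 1)).filter (fun k => ∃ i, 2 * e < topValue μ - μ i ∧
        topValue μ - μ i ≤ 2 * confRadius (2 ^ k) T), 2 * confRadius (2 ^ k) T *
      ((roundBlock X Y T M b t k).indicator 1 ω + (F k).indicator 1 ω) := by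
  classical
  have hnonneg : ∀ k, 0 ≤ 2 * confRadius (2 ^ k) T *
      ((roundBlock X Y T M b t k).indicator (1 : Ω → ℝ) ω + (F k).indicator 1 ω) := fun k =>
    mul_nonneg (mul_nonneg two_pos.le (confRadius_nonneg _ _))
      (add_nonneg (Set.indicator_nonneg (fun _ _ => zero_le_one) _)
        (Set.indicator_nonneg (fun _ _ => zero_le_one) _))
  split_ifs with hgap
  swap
  · exact Finset.sum_nonneg fun k _ => hnonneg k
  obtain ⟨j, hj⟩ := exists_eq_topValue μ
  have hjle : ∀ i, μ i ≤ μ j := fun i => hj ▸ le_topValue μ i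
  -- The index `r`, a round or a failed level, is rounded down to a power of two, which only
  -- enlarges the radius. The chosen arm itself witnesses the filter, and one term of the
  -- nonnegative sum already suffices.
  have key : ∀ r : ℕ, 1 ≤ r → r ≤ n →
      topValue μ - μ (binState X Y T M b t ω).arm ≤ 2 * confRadius r T →
      (1 : ℝ) ≤ (roundBlock X Y T M b t (Nat.log 2 r)).indicator 1 ω +
        (F (Nat.log 2 r)).indicator 1 ω →
      topValue μ - μ (binState X Y T M b t ω).arm ≤
      ∑ k ∈ (Finset.range (n + 1)).filter (fun k => ∃ i, 2 * e < topValue μ - μ i ∧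
          topValue μ - μ i ≤ 2 * confRadius (2 ^ k) T), 2 * confRadius (2 ^ k) T *
        ((roundBlock X Y T M b t k).indicator 1 ω + (F k).indicator 1 ω) := by
    intro r hr1 hrn hle hone
    have hpow : 2 ^ Nat.log 2 r ≤ r := Nat.pow_log_le_self 2 (by omega)
    have hle' : topValue μ - μ (binState X Y T M b t ω).arm ≤
        2 * confRadius (2 ^ Nat.log 2 r) T := by
      have := confRadius_antitone hT Nat.one_le_two_pow hpow
      linarith
    have hmem : Nat.log 2 r ∈ (Finset.range (n + 1)).filter (fun k => ∃ i,
        2 * e < topValue μ - μ i ∧ topValue μ - μ i ≤ 2 * confRadius (2 ^ k) T) := by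
      refine Finset.mem_filter.2 ⟨?_, _, hgap, hle'⟩
      have := Nat.log_le_self 2 r
      exact Finset.mem_range.2 (by omega)
    refine le_trans ?_ (Finset.single_le_sum (fun k _ => hnonneg k) hmem)
    have h0 := confRadius_nonneg (2 ^ Nat.log 2 r) T
    nlinarith
  have hround : (binState X Y T M b t ω).round ≤ t + 1 :=
    round_le T (fun u => binIndex M (X u ω) = b) (fun u i => Y u i ω) t
  have hlog : ∀ r : ℕ, 1 ≤ r → 2 ^ Nat.log 2 r ≤ r ∧ r < 2 * 2 ^ Nat.log 2 r := fun r hr =>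
    ⟨Nat.pow_log_le_self 2 (by omega), by
      rw [← pow_succ']; exact Nat.lt_pow_succ_log_self one_lt_two r⟩
  rcases gap_arm_le (T := T) (s := fun u => binIndex M (X u ω) = b) (y := fun u i => Y u i ω)
    hμ hjle t with h | ⟨m, hm1, hm, ⟨i, hi⟩, h⟩
  · have hr1 : 1 ≤ (binState X Y T M b t ω).round := by
      unfold binState; rw [round_eq_pullCount_arm]; omega
    refine key _ hr1 (by omega) (by rw [← hj]; exact h) ?_
    have : ω ∈ roundBlock X Y T M b t (Nat.log 2 (binState X Y T M b t ω).round) := hlog _ hr1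
    rw [Set.indicator_of_mem this]
    exact le_add_of_nonneg_right (Set.indicator_nonneg (fun _ _ => zero_le_one) _)
  · have hm' : m < (binState X Y T M b t ω).round := hm
    refine key m hm1 (by omega) (by rw [← hj]; exact h) ?_
    have : ω ∈ F (Nat.log 2 m) := by
      refine hF _ (Set.mem_iUnion.2 ⟨i, m, (hlog m hm1).1, (hlog m hm1).2, hi.mono ht.le⟩)
    rw [Set.indicator_of_mem this]
    exact le_add_of_nonneg_left (Set.indicator_nonneg (fun _ _ => zero_le_one) _)

theorem measurableSet_roundBlock_past (T : ℝ) (M : ℕ) (b : Fin d → ℕ) (t k : ℕ) :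
    MeasurableSet[past X Y t] (roundBlock X Y T M b t k) :=
  (adaptedState_binState (X := X) (Y := Y) T M b t).measurable_round
    (t := Set.Ico (2 ^ k) (2 * 2 ^ k)) trivial

variable [MeasurableSpace Ω] {P : Measure Ω} {PX : Measure (Pt d)} {f : Fin K → Pt d → ℝ}

namespace IsMachine

variable (h : IsMachine P X Y PX f)
include h

theorem measureReal_blockFails_le {T : ℝ} (hT : 0 < T) (M : ℕ) (b : Fin d → ℕ)
    (hf : ∀ i, AEStronglyMeasurable (f i) PX) (n k : ℕ) :
    P.real (blockFails X Y (binMean PX f M b) T M b n k) ≤ K * (4 * 2 ^ k / T) := by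
  refine ENNReal.toReal_le_of_le_ofReal (by positivity) ?_
  calc _ ≤ ∑ i : Fin K, P _ := measure_iUnion_fintype_le P _
    _ ≤ ∑ _i : Fin K, ENNReal.ofReal (4 * (2 ^ k : ℕ) / T) :=
        Finset.sum_le_sum fun i _ => h.measure_levelFails_le hT M b i (hf i) Nat.one_le_two_pow n
    _ = _ := by
        rw [Finset.sum_const, Finset.card_univ, Fintype.card_fin, nsmul_eq_mul,
          ENNReal.ofReal_mul (by positivity), ENNReal.ofReal_natCast]
        push_cast
        rfl

/-- The regret uses a fresh covariate, the count actual visits. Since the state at time `t` is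
independent of `X t`, each product is the probability of a visit during the block, and on every path
there are at most `K 2^k` such visits. -/
theorem sum_measureReal_roundBlock_le (T : ℝ) (M : ℕ) (b : Fin d → ℕ) (n k : ℕ) :
    ∑ t ∈ Finset.range n, PX.real (binSet d M b) * P.real (roundBlock X Y T M b t k) ≤
      K * 2 ^ k := by
  classical
  have := h.isProb
  set A : ℕ → Set Ω := fun t => roundBlock X Y T M b t k ∩ X t ⁻¹' binSet d M b with hA
  have hAm : ∀ t, MeasurableSet (A t) := fun t =>
    (h.past_le t _ (measurableSet_roundBlock_past T M b t k)).inter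
      (h.measurable_X t (measurableSet_binSet M b))
  have h1 : ∀ t, PX.real (binSet d M b) * P.real (roundBlock X Y T M b t k) = P.real (A t) := by
    intro t
    have := (Indep_iff _ _ P).1 (h.indep_past t) _ (X t ⁻¹' binSet d M b)
      (measurableSet_roundBlock_past T M b t k)
      ⟨Prod.fst ⁻¹' binSet d M b, measurable_fst (measurableSet_binSet M b), rfl⟩
    rw [hA, Measure.real, Measure.real, Measure.real, this, ENNReal.toReal_mul,
      h.measure_preimage t (measurableSet_binSet M b), mul_comm]
  simp_rw [h1]
  have h2 : ∀ t, P.real (A t) = ∫ ω, (A t).indicator (fun _ => (1 : ℝ)) ω ∂P := fun t =>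
    (integral_indicator_one (hAm t)).symm
  simp_rw [h2]
  rw [← integral_finsetSum _ fun t _ => (integrable_const (1 : ℝ)).indicator (hAm t)]
  calc ∫ ω, ∑ t ∈ Finset.range n, (A t).indicator (fun _ => (1 : ℝ)) ω ∂P
      ≤ ∫ _ω, (K * 2 ^ k : ℝ) ∂P := by
        refine integral_mono (integrable_finsetSum _ fun t _ =>
          (integrable_const (1 : ℝ)).indicator (hAm t)) (integrable_const _) fun ω => ?_
        have hc := card_round_block_le T (fun u => binIndex M (X u ω) = b) (fun u i => Y u i ω) n
          (2 ^ k) (2 * 2 ^ k)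
        rw [two_mul, Nat.add_sub_cancel] at hc
        calc ∑ t ∈ Finset.range n, (A t).indicator (fun _ => (1 : ℝ)) ω
            = ((Finset.range n).filter (fun t => ω ∈ A t)).card := by
              rw [Finset.card_filter]
              push_cast
              refine Finset.sum_congr rfl fun t _ => ?_
              simp [Set.indicator_apply]
          _ ≤ ((K * 2 ^ k : ℕ) : ℝ) := by
              rw [Nat.cast_le]
              refine le_trans (Finset.card_le_card fun t ht => ?_) hc
              rw [Finset.mem_filter] at ht ⊢
              obtain ⟨ht, ⟨h1, h2⟩, h3⟩ := ht
              exact ⟨ht, h3, h1, by rw [← two_mul]; exact h2⟩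
          _ = _ := by push_cast; ring
    _ = _ := by simp

end IsMachine

end PerBin

/-! ### Summation over all bins -/

section Total

variable {d K : ℕ} [NeZero K] {Ω : Type*} {X : ℕ → Ω → Pt d} {Y : ℕ → Fin K → Ω → ℝ}

/-- The indices of the bins. -/
def binIndices (d M : ℕ) : Finset (Fin d → ℕ) := Fintype.piFinset fun _ => Finset.range M

theorem mem_binIndices {M : ℕ} {b : Fin d → ℕ} : b ∈ binIndices d M ↔ ∀ l, b l < M := by
  simp [binIndices]

theorem iUnion_binSet {M : ℕ} (hM : 0 < M) : ⋃ b ∈ binIndices d M, binSet d M b = Set.univ := by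
  refine Set.eq_univ_of_forall fun x => Set.mem_iUnion₂.2 ⟨binIndex M x, ?_, rfl⟩
  rw [mem_binIndices]
  intro l
  unfold binIndex
  omega

theorem pairwiseDisjoint_binSet (M : ℕ) (S : Set (Fin d → ℕ)) :
    S.PairwiseDisjoint (binSet d M) := fun _ _ _ _ hbb' =>
  Set.disjoint_left.2 fun _ hx hx' => hbb' (hx.symm.trans hx')

variable {PX : Measure (Pt d)} {f : Fin K → Pt d → ℝ} {cl cu β L : ℝ}

theorem regret_eq_sum [IsProbabilityMeasure PX] (hd : DensityCondition PX cl cu)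
    (hs : SmoothnessCondition f β L) (hβ : 0 < β)
    (hf : ∀ i, ∀ x ∈ cube d, 0 ≤ f i x ∧ f i x ≤ 1) {M : ℕ} (hM : 0 < M) (T : ℝ) (n : ℕ) (ω : Ω) :
    regret (binnedSE M 1 T) X Y PX f n ω =
      ∑ t ∈ Finset.range n, ∑ b ∈ binIndices d M, ∫ x in binSet d M b,
        (topValue (fun i => f i x) - f (binState X Y T M b t ω).arm x) ∂PX := by
  unfold regret
  refine Finset.sum_congr rfl fun t _ => ?_
  have hcongr : ∀ b, Set.EqOn
      (fun x => topValue (fun i => f i x) -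
        f (binnedSE M 1 T (history (binnedSE M 1 T) X Y t ω) x) x)
      (fun x => topValue (fun i => f i x) - f (binState X Y T M b t ω).arm x)
      (binSet d M b) := by
    intro b x hx
    simp only [binnedSE_apply, mem_binSet.1 hx]
  rw [← setIntegral_univ, ← iUnion_binSet hM, integral_biUnion_finset _
    (fun b _ => measurableSet_binSet M b) (pairwiseDisjoint_binSet M _)]
  · exact Finset.sum_congr rfl fun b _ =>
      setIntegral_congr_fun (measurableSet_binSet M b) (hcongr b)
  · intro b _
    rw [integrableOn_congr_fun (hcongr b) (measurableSet_binSet M b)]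
    exact ((hd.integrable_topValue hs hβ hf).sub (hd.integrable hs hβ hf _)).integrableOn

variable [MeasurableSpace Ω] {P : Measure Ω}

namespace IsMachine

variable (h : IsMachine P X Y PX f)
include h

theorem integrable_comp_arm (T : ℝ) (M : ℕ) (b : Fin d → ℕ) (t : ℕ) (r : Fin K → ℝ) :
    Integrable (fun ω => r (binState X Y T M b t ω).arm) P := by
  have := h.isProb
  have hm : Measurable fun ω => (binState X Y T M b t ω).arm :=
    measurable_to_countable' fun i =>
      h.past_le t _ ((adaptedState_binState T M b t).measurableSet_arm i)
  refine Integrable.of_bound ((measurable_of_finite r).comp hm).aestronglyMeasurable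
    (∑ i, ‖r i‖) (Filter.Eventually.of_forall fun ω => ?_)
  exact Finset.single_le_sum (f := fun i => ‖r i‖) (fun i _ => norm_nonneg _) (Finset.mem_univ _)

/-- The regret is a finite sum of functions of the arms chosen in the bins, so it is measurable and
bounded. -/
theorem integrable_regret (hd : DensityCondition PX cl cu)
    (hs : SmoothnessCondition f β L) (hβ : 0 < β) {M : ℕ} (hM : 0 < M) (T : ℝ) (n : ℕ) :
    Integrable (regret (binnedSE M 1 T) X Y PX f n) P := by
  have := h.isProbabilityMeasure_PX
  refine Integrable.congr (f := fun ω => ∑ t ∈ Finset.range n, ∑ b ∈ binIndices d M,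
    ∫ x in binSet d M b, (topValue (fun i => f i x) - f (binState X Y T M b t ω).arm x) ∂PX) ?_
    (Filter.Eventually.of_forall fun ω =>
      (regret_eq_sum hd hs hβ h.mean_mem hM T n ω).symm)
  refine integrable_finsetSum _ fun t _ => integrable_finsetSum _ fun b _ => ?_
  exact h.integrable_comp_arm T M b t
    (fun i => ∫ x in binSet d M b, (topValue (fun i => f i x) - f i x) ∂PX)

/-- The expected regret of binned Successive Elimination in terms of dyadic blocks of rounds. -/
theorem integral_regret_le (hd : DensityCondition PX cl cu) (hs : SmoothnessCondition f β L)
    (hβ : 0 < β) (hL : 0 < L) (hcl : 0 < cl) (hcu : 0 ≤ cu) {M : ℕ} (hM : 0 < M) {n : ℕ}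
    (hn : 0 < n) {H : ℝ → ℝ} (hH : ∀ δ, 0 ≤ δ →
      PX.real {x | 0 < topValue (fun i => f i x) - secondValue (fun i => f i x) ∧
        topValue (fun i => f i x) - secondValue (fun i => f i x) ≤ δ} ≤ H δ) :
    ∫ ω, regret (binnedSE M 1 (n / (M : ℝ) ^ d)) X Y PX f n ω ∂P ≤
      n * (4 * oscillation d M β L * H (4 * oscillation d M β L)) +
      ∑ k ∈ (Finset.range (n + 1)).filter
          (fun k => oscillation d M β L < confRadius (2 ^ k) (n / (M : ℝ) ^ d)),
        4 * confRadius (2 ^ k) (n / (M : ℝ) ^ d) * (K * 2 ^ k * (1 + 4 * cu)) *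
          (H (4 * confRadius (2 ^ k) (n / (M : ℝ) ^ d)) * ((M : ℝ) ^ d / cl)) := by
  classical
  have hPX := h.isProbabilityMeasure_PX
  have hP := h.isProb
  have hM' : (0 : ℝ) < M := by exact_mod_cast hM
  have hn' : (0 : ℝ) < n := by exact_mod_cast hn
  set T : ℝ := n / (M : ℝ) ^ d with hTdef
  have hT : 0 < T := by positivity
  set ε := oscillation d M β L with hε
  have hε0 : 0 ≤ ε := by rw [hε]; unfold oscillation; positivity
  set V0 := {x | 0 < topValue (fun i => f i x) - secondValue (fun i => f i x) ∧
        topValue (fun i => f i x) - secondValue (fun i => f i x) ≤ 4 * ε} with hV0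
  -- Off the cube `f` is arbitrary, so the margin region may not be measurable; its hull has the
  -- same mass.
  set V := toMeasurable PX V0 with hV
  have hVm : MeasurableSet V := measurableSet_toMeasurable _ _
  have hVle : PX.real V ≤ H (4 * ε) := by
    rw [hV, Measure.real, measure_toMeasurable]
    exact hH _ (by positivity)
  have hfm : ∀ i, AEStronglyMeasurable (f i) PX := hs.aestronglyMeasurable hβ hd
  set μ : (Fin d → ℕ) → Fin K → ℝ := fun b => binMean PX f M b with hμ
  have hμ01 : ∀ b ∈ binIndices d M, ∀ i, 0 ≤ μ b i ∧ μ b i ≤ 1 := by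
    intro b hb i
    refine hd.binMean_mem ?_ (hd.integrable hs hβ h.mean_mem i) fun x hx _ => h.mean_mem i x hx
    intro h0
    have := hd.le_bin hcl.le hM (mem_binIndices.1 hb)
    rw [Measure.real, h0, ENNReal.toReal_zero] at this
    exact this.not_gt (by positivity)
  set F : (Fin d → ℕ) → ℕ → Set Ω := fun b k =>
    toMeasurable P (blockFails X Y (μ b) T M b n k) with hF
  have hFm : ∀ b k, MeasurableSet (F b k) := fun b k => measurableSet_toMeasurable _ _
  have hFP : ∀ b k, P.real (F b k) ≤ K * (4 * 2 ^ k / T) := by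
    intro b k
    rw [hF, Measure.real, measure_toMeasurable]
    exact h.measureReal_blockFails_le hT M b hfm n k
  have hRm : ∀ b t k, MeasurableSet (roundBlock X Y T M b t k) := fun b t k =>
    h.past_le t _ (measurableSet_roundBlock_past T M b t k)
  set U : ℕ → ℝ := fun k => confRadius (2 ^ k) T with hU
  have hU0 : ∀ k, 0 ≤ U k := fun k => confRadius_nonneg _ _
  set Q : (Fin d → ℕ) → ℕ → Prop := fun b k => ∃ i, 2 * ε < topValue (μ b) - μ b i ∧
    topValue (μ b) - μ b i ≤ 2 * U k with hQ
  have hpath : ∀ ω, regret (binnedSE M 1 T) X Y PX f n ω ≤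
      n * (4 * ε * H (4 * ε)) + ∑ b ∈ binIndices d M, ∑ k ∈ (Finset.range (n + 1)).filter (Q b),
        4 * U k * ∑ t ∈ Finset.range n, PX.real (binSet d M b) *
          ((roundBlock X Y T M b t k).indicator 1 ω + (F b k).indicator 1 ω) := by
    intro ω
    rw [regret_eq_sum hd hs hβ h.mean_mem hM]
    have hone : ∀ t < n, ∀ b ∈ binIndices d M,
        ∫ x in binSet d M b, (topValue (fun i => f i x) - f (binState X Y T M b t ω).arm x) ∂PX ≤
        4 * ε * PX.real (V ∩ binSet d M b) + ∑ k ∈ (Finset.range (n + 1)).filter (Q b),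
          4 * U k * (PX.real (binSet d M b) *
            ((roundBlock X Y T M b t k).indicator 1 ω + (F b k).indicator 1 ω)) := by
      intro t ht b hb
      refine (setIntegral_regret_le hd hs hβ hL h.mean_mem hM hVm (subset_toMeasurable _ _) b
        _).trans (add_le_add le_rfl ?_)
      have := gap_arm_le_sum (X := X) (Y := Y) hT (hμ01 b hb) M b ht hε0 ω (F := F b)
        (fun k => subset_toMeasurable _ _)
      calc _ ≤ PX.real (binSet d M b) * (2 * ∑ k ∈ (Finset.range (n + 1)).filter (Q b),
            2 * U k * ((roundBlock X Y T M b t k).indicator 1 ω + (F b k).indicator 1 ω)) := by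
            gcongr
            exact this
        _ = _ := by
            rw [Finset.mul_sum, Finset.mul_sum]
            exact Finset.sum_congr rfl fun k _ => by ring
    calc _ ≤ ∑ t ∈ Finset.range n, ∑ b ∈ binIndices d M,
          (4 * ε * PX.real (V ∩ binSet d M b) + ∑ k ∈ (Finset.range (n + 1)).filter (Q b),
          4 * U k * (PX.real (binSet d M b) *
            ((roundBlock X Y T M b t k).indicator 1 ω + (F b k).indicator 1 ω))) :=
          Finset.sum_le_sum fun t ht => Finset.sum_le_sum fun b hb =>
            hone t (Finset.mem_range.1 ht) b hb
      _ = n * (4 * ε * ∑ b ∈ binIndices d M, PX.real (V ∩ binSet d M b)) +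
          ∑ b ∈ binIndices d M, ∑ k ∈ (Finset.range (n + 1)).filter (Q b),
          4 * U k * ∑ t ∈ Finset.range n, PX.real (binSet d M b) *
            ((roundBlock X Y T M b t k).indicator 1 ω + (F b k).indicator 1 ω) := by
          simp_rw [Finset.sum_add_distrib]
          rw [Finset.sum_const, Finset.card_range, nsmul_eq_mul, ← Finset.mul_sum]
          congr 1
          rw [Finset.sum_comm]
          refine Finset.sum_congr rfl fun b _ => ?_
          rw [Finset.sum_comm]
          exact Finset.sum_congr rfl fun k _ => (Finset.mul_sum _ _ _).symm
      _ ≤ _ := by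
          have : ∑ b ∈ binIndices d M, PX.real (V ∩ binSet d M b) = PX.real V := by
            rw [← measureReal_biUnion_finset]
            · rw [← Set.inter_iUnion₂, iUnion_binSet hM, Set.inter_univ]
            · exact (pairwiseDisjoint_binSet M _).mono fun b => Set.inter_subset_right
            · exact fun b _ => hVm.inter (measurableSet_binSet M b)
          rw [this]
          gcongr
  have hint1 : ∀ {A : Set Ω}, MeasurableSet A → Integrable (A.indicator (1 : Ω → ℝ)) P :=
    fun hA => (integrable_const (1 : ℝ)).indicator hA
  have hterm : ∀ b t k, Integrable (fun ω => PX.real (binSet d M b) *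
      ((roundBlock X Y T M b t k).indicator 1 ω + (F b k).indicator 1 ω)) P := fun b t k =>
    ((hint1 (hRm b t k)).add (hint1 (hFm b k))).const_mul _
  have hinner : ∀ b k, Integrable (fun ω => 4 * U k * ∑ t ∈ Finset.range n,
      PX.real (binSet d M b) *
        ((roundBlock X Y T M b t k).indicator 1 ω + (F b k).indicator 1 ω)) P := fun b k =>
    (integrable_finsetSum _ fun t _ => hterm b t k).const_mul _
  have hinner_le : ∀ b k, ∫ ω, 4 * U k * ∑ t ∈ Finset.range n, PX.real (binSet d M b) *
        ((roundBlock X Y T M b t k).indicator 1 ω + (F b k).indicator 1 ω) ∂P ≤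
      4 * U k * (K * 2 ^ k * (1 + 4 * cu)) := by
    intro b k
    rw [integral_const_mul, integral_finsetSum _ fun t _ => hterm b t k]
    have e : ∀ t, ∫ ω, PX.real (binSet d M b) *
        ((roundBlock X Y T M b t k).indicator 1 ω + (F b k).indicator 1 ω) ∂P =
        PX.real (binSet d M b) * P.real (roundBlock X Y T M b t k) +
          PX.real (binSet d M b) * P.real (F b k) := by
      intro t
      rw [integral_const_mul, integral_add (hint1 (hRm b t k)) (hint1 (hFm b k)),
        integral_indicator_one (hRm b t k), integral_indicator_one (hFm b k), mul_add]
    simp_rw [e]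
    rw [Finset.sum_add_distrib, Finset.sum_const, Finset.card_range, nsmul_eq_mul]
    have h1 := h.sum_measureReal_roundBlock_le T M b n k
    -- The choice `T = n M^{-d}` matters here: the expected number of visits, at most `cu T`,
    -- cancels the `1/T` in the failure probability.
    have h2 : (n : ℝ) * (PX.real (binSet d M b) * P.real (F b k)) ≤ K * 2 ^ k * (4 * cu) := by
      calc (n : ℝ) * (PX.real (binSet d M b) * P.real (F b k))
          ≤ n * ((cu / (M : ℝ) ^ d) * (K * (4 * 2 ^ k / T))) := by
            gcongr
            · exact hd.bin_le hcu hM b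
            · exact hFP b k
        _ = K * 2 ^ k * (4 * cu) := by
            rw [hTdef]; field_simp
    have h3 := hU0 k
    gcongr
    linarith
  have hQcard : ∀ k, ((binIndices d M).filter (fun b => Q b k)).card ≤
      H (4 * U k) * ((M : ℝ) ^ d / cl) := by
    intro k
    have h1 := card_bins_le hd hs hβ hL h.mean_mem hM hcl (u := U k)
      ((binIndices d M).filter (fun b => Q b k)) (fun b hb => by
        obtain ⟨hb1, hb2⟩ := Finset.mem_filter.1 hb
        exact ⟨mem_binIndices.1 hb1, hb2⟩)
    have h2 := h1.trans (hH _ (by have := hU0 k; positivity))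
    calc (((binIndices d M).filter (fun b => Q b k)).card : ℝ)
        = ((binIndices d M).filter (fun b => Q b k)).card * (cl / (M : ℝ) ^ d) *
          ((M : ℝ) ^ d / cl) := by field_simp
      _ ≤ _ := by gcongr
  have hQU : ∀ b k, Q b k → ε < U k := fun b k ⟨i, h1, h2⟩ => by linarith
  calc ∫ ω, regret (binnedSE M 1 T) X Y PX f n ω ∂P
      ≤ ∫ ω, (n * (4 * ε * H (4 * ε)) + ∑ b ∈ binIndices d M,
        ∑ k ∈ (Finset.range (n + 1)).filter (Q b),
        4 * U k * ∑ t ∈ Finset.range n, PX.real (binSet d M b) *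
          ((roundBlock X Y T M b t k).indicator 1 ω + (F b k).indicator 1 ω)) ∂P :=
        integral_mono (h.integrable_regret hd hs hβ hM T n)
          ((integrable_const _).add (integrable_finsetSum _ fun b _ =>
            integrable_finsetSum _ fun k _ => hinner b k)) hpath
    _ = n * (4 * ε * H (4 * ε)) + ∑ b ∈ binIndices d M,
        ∑ k ∈ (Finset.range (n + 1)).filter (Q b),
        ∫ ω, 4 * U k * ∑ t ∈ Finset.range n, PX.real (binSet d M b) *
          ((roundBlock X Y T M b t k).indicator 1 ω + (F b k).indicator 1 ω) ∂P := by
        rw [integral_add (integrable_const _) (integrable_finsetSum _ fun b _ =>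
          integrable_finsetSum _ fun k _ => hinner b k), integral_finsetSum _ fun b _ =>
          integrable_finsetSum _ fun k _ => hinner b k]
        congr 1
        · simp
        · exact Finset.sum_congr rfl fun b _ => integral_finsetSum _ fun k _ => hinner b k
    _ ≤ n * (4 * ε * H (4 * ε)) + ∑ b ∈ binIndices d M,
        ∑ k ∈ (Finset.range (n + 1)).filter (Q b), 4 * U k * (K * 2 ^ k * (1 + 4 * cu)) :=
        add_le_add le_rfl (Finset.sum_le_sum fun b _ => Finset.sum_le_sum fun k _ =>
          hinner_le b k)
    _ ≤ _ := by
        refine add_le_add le_rfl ?_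
        -- The cost of a block is the same for all bins, so after exchanging the sums only the
        -- number of bins concerned is left.
        simp_rw [Finset.sum_filter]
        rw [Finset.sum_comm]
        refine Finset.sum_le_sum fun k _ => ?_
        rw [← Finset.sum_filter, Finset.sum_const, nsmul_eq_mul]
        have h0 : 0 ≤ 4 * U k * (K * 2 ^ k * (1 + 4 * cu)) := by
          have := hU0 k; positivity
        split_ifs with hk
        · rw [mul_comm]
          exact mul_le_mul_of_nonneg_left (hQcard k) h0
        · have : (binIndices d M).filter (fun b => Q b k) = ∅ :=
            Finset.filter_eq_empty_iff.2 fun b _ hb => hk (hQU b k hb)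
          rw [this]
          simp

end IsMachine

end Total

/-! ### Consequences of the choice of `M` -/

section Rate

/-- Before rounding down, the number of bins per axis is a real `r ≥ 1`, so `r/2 ≤ M ≤ r`;
everything follows from `r^(2β+d) = n / (K log K)`. -/
theorem binCount_bounds {d K n : ℕ} {β : ℝ} (hβ : 0 < β) (hK : 2 ≤ K)
    (hn : (K : ℝ) * Real.log K ≤ n) :
    0 < binCount d K n β ∧
      K * Real.log K * (binCount d K n β : ℝ) ^ (2 * β + d) ≤ n ∧
      n ≤ K * Real.log K * (2 * (binCount d K n β : ℝ)) ^ (2 * β + d) ∧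
      ∀ γ : ℝ, 0 ≤ γ → (binCount d K n β : ℝ) ^ (-γ) ≤
        2 ^ γ * (K * Real.log K / n) ^ (γ / (2 * β + d)) := by
  have hK' : (2 : ℝ) ≤ K := by exact_mod_cast hK
  have hlog : 0 < Real.log K := Real.log_pos (by linarith)
  set κ := (K : ℝ) * Real.log K with hκ
  have hκ0 : 0 < κ := by positivity
  have hn0 : (0 : ℝ) < n := hκ0.trans_le hn
  set s := 2 * β + (d : ℝ) with hs
  have hs0 : 0 < s := by positivity
  set R := (n : ℝ) / κ with hR
  have hR1 : 1 ≤ R := by rw [hR, one_le_div hκ0]; exact hn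
  set r := R ^ (1 / s) with hr
  have hr1 : 1 ≤ r := Real.one_le_rpow hR1 (by positivity)
  have hrs : r ^ s = R := by
    rw [hr, ← Real.rpow_mul (by linarith), one_div_mul_cancel hs0.ne', Real.rpow_one]
  have hM : binCount d K n β = ⌊r⌋₊ := rfl
  rw [hM]
  have hM1 : 1 ≤ ⌊r⌋₊ := (Nat.one_le_floor_iff _).2 hr1
  have hM1' : (1 : ℝ) ≤ ⌊r⌋₊ := by exact_mod_cast hM1
  have hle : (⌊r⌋₊ : ℝ) ≤ r := Nat.floor_le (by linarith)
  have hlt : r ≤ 2 * (⌊r⌋₊ : ℝ) := by linarith [Nat.lt_floor_add_one r]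
  have hnR : (n : ℝ) = κ * R := by rw [hR]; field_simp
  refine ⟨hM1, ?_, ?_, fun γ hγ => ?_⟩
  · rw [hnR, ← hrs]
    gcongr
  · rw [hnR, ← hrs]
    gcongr
  · calc (⌊r⌋₊ : ℝ) ^ (-γ) ≤ (r / 2) ^ (-γ) :=
          Real.rpow_le_rpow_of_nonpos (by positivity) (by linarith) (by linarith)
      _ = 2 ^ γ * r ^ (-γ) := by
          rw [Real.div_rpow (by positivity) two_pos.le, Real.rpow_neg two_pos.le]
          field_simp
      _ = 2 ^ γ * (κ / n) ^ (γ / s) := by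
          rw [hr, ← Real.rpow_mul (by linarith), ← inv_div (n : ℝ) κ, Real.inv_rpow (by positivity),
            ← Real.rpow_neg (by positivity)]
          congr 2
          ring

/-- The argument of the logarithm is `n / M^(2β+d) ≤ K log K · 2^(2β+d)`, and `log K ≤ K`, `2 ≤ K`
make this a fixed power of `K`. Hence the rate contains `log K` but not `log n`. -/
theorem log_ratio_le {d K n M : ℕ} {β : ℝ} (hβ : 0 < β) (hK : 2 ≤ K) (hM : 0 < M) (hn : 0 < n)
    (h : n ≤ K * Real.log K * (2 * (M : ℝ)) ^ (2 * β + d)) :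
    Real.log (n / (M : ℝ) ^ d * (M : ℝ) ^ (-(2 * β))) ≤ (2 + (2 * β + d)) * Real.log K := by
  have hK' : (2 : ℝ) ≤ K := by exact_mod_cast hK
  have hM' : (0 : ℝ) < M := by exact_mod_cast hM
  have hn' : (0 : ℝ) < n := by exact_mod_cast hn
  have hlog : 0 < Real.log K := Real.log_pos (by linarith)
  have hlogK : Real.log K ≤ K := (Real.log_le_sub_one_of_pos (by linarith)).trans (by linarith)
  have h1 : n / (M : ℝ) ^ d * (M : ℝ) ^ (-(2 * β)) ≤ K ^ 2 * (K : ℝ) ^ (2 * β + d) := by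
    have e : n / (M : ℝ) ^ d * (M : ℝ) ^ (-(2 * β)) = n / (M : ℝ) ^ (2 * β + d) := by
      rw [Real.rpow_neg hM'.le, Real.rpow_add hM', Real.rpow_natCast]
      field_simp
    rw [e, div_le_iff₀ (by positivity)]
    calc (n : ℝ) ≤ K * Real.log K * (2 * (M : ℝ)) ^ (2 * β + d) := h
      _ = K * Real.log K * (2 ^ (2 * β + d) * (M : ℝ) ^ (2 * β + d)) := by
          rw [Real.mul_rpow two_pos.le hM'.le]
      _ ≤ K * K * ((K : ℝ) ^ (2 * β + d) * (M : ℝ) ^ (2 * β + d)) := by gcongr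
      _ = _ := by ring
  calc _ ≤ Real.log (K ^ 2 * (K : ℝ) ^ (2 * β + d)) := Real.log_le_log (by positivity) h1
    _ = _ := by
        rw [Real.log_mul (by positivity) (by positivity), Real.log_pow,
          Real.log_rpow (by linarith)]
        push_cast
        ring

end Rate

end CovBandit

end

/-! ### Assembly of the regret bound -/

theorem theorem2 (d : ℕ) (hd : 1 ≤ d) (α β L cl cu δ₀ C₀ : ℝ)
    (hα : 0 < α) (hα1 : α < 1) (hβ : 0 < β) (hβ1 : β ≤ 1) (hL : 0 < L)
    (hcl : 0 < cl) (hcu : 0 < cu) (hδ₀ : 0 < δ₀) (hδ₀1 : δ₀ < 1) (hC₀ : 0 < C₀) :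
    ∃ C : ℝ, 0 < C ∧
      ∀ (K : ℕ) [NeZero K], 2 ≤ K →
      ∀ n : ℕ, (K : ℝ) * Real.log K ≤ n →
      ∀ (Ω : Type*) [MeasurableSpace Ω] (P : MeasureTheory.Measure Ω)
        (X : ℕ → Ω → CovBandit.Pt d) (Y : ℕ → Fin K → Ω → ℝ)
        (PX : MeasureTheory.Measure (CovBandit.Pt d)) (f : Fin K → CovBandit.Pt d → ℝ),
        CovBandit.IsMachine P X Y PX f →
        CovBandit.DensityCondition PX cl cu →
        CovBandit.SmoothnessCondition f β L →
        CovBandit.MarginCondition PX f α δ₀ C₀ →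
          MeasureTheory.Integrable
            (CovBandit.regret (CovBandit.bse n β) X Y PX f n) P ∧
          ∫ ω, CovBandit.regret (CovBandit.bse n β) X Y PX f n ω ∂P ≤
            C * n * ((K : ℝ) * Real.log K / n) ^ (β * (α + 1) / (2 * β + d)) := by
  have hd' : (1 : ℝ) ≤ d := by exact_mod_cast hd
  -- The oscillation is `c M^{-β}`, so `sum_confRadius_le` is applied with `a = M^{-2β}` and `lam =
  -- log K`.
  set c := L * (√(d : ℝ)) ^ β with hc
  have hc0 : 0 < c := by positivity
  obtain ⟨Cs, hCs, hsum⟩ := CovBandit.sum_confRadius_le (c₁ := 2 + (2 * β + d)) hα hα1 hc0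
    (by positivity)
  set C₁ := C₀ + (δ₀ ^ α)⁻¹ with hC₁
  have hC₁0 : 0 < C₁ := by positivity
  set A₁ := 4 * c * (C₁ * (4 * c) ^ α) with hA₁
  set A₂ := 4 * (1 + 4 * cu) * (C₁ * 4 ^ α / cl) with hA₂
  have hA₁0 : 0 < A₁ := by positivity
  have hA₂0 : 0 < A₂ := by positivity
  refine ⟨2 ^ (β * (α + 1)) * (A₁ + A₂ * Cs), by positivity, ?_⟩
  intro K _ hK n hn Ω _ P X Y PX f hmach hdens hsmooth hmargin
  have hPX := hmach.isProbabilityMeasure_PX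
  obtain ⟨hM, hMn, hnM, hMrate⟩ := CovBandit.binCount_bounds (d := d) hβ hK hn
  set M := CovBandit.binCount d K n β with hMdef
  have hM' : (0 : ℝ) < M := by exact_mod_cast hM
  have hK' : (2 : ℝ) ≤ K := by exact_mod_cast hK
  have hlog : 1 / 2 ≤ Real.log K := by
    have h1 := Real.log_two_gt_d9
    have h2 := Real.log_le_log two_pos hK'
    linarith
  have hlog0 : 0 < Real.log K := by linarith
  have hn' : (0 : ℝ) < n := lt_of_lt_of_le (by positivity) hn
  have hn0 : 0 < n := by exact_mod_cast hn'
  have hbse : (CovBandit.bse n β : CovBandit.Policy d K) =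
      CovBandit.binnedSE M 1 ((n : ℝ) / (M : ℝ) ^ d) := rfl
  rw [hbse]
  refine ⟨hmach.integrable_regret hdens hsmooth hβ hM _ n, ?_⟩
  refine (hmach.integral_regret_le hdens hsmooth hβ hL hcl hcu.le hM hn0
    (H := fun δ => C₁ * δ ^ α)
    fun δ hδ => hmargin.le_of_nonneg hα hδ₀ hC₀ hδ).trans ?_
  set T := (n : ℝ) / (M : ℝ) ^ d with hT
  have hosc : CovBandit.oscillation d M β L = c * (M : ℝ) ^ (-β) := by
    unfold CovBandit.oscillation
    rw [Real.div_rpow (by positivity) hM'.le, Real.rpow_neg hM'.le, hc]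
    ring
  have hosc0 : 0 < c * (M : ℝ) ^ (-β) := by positivity
  have hsqM : ((M : ℝ) ^ (-β)) ^ 2 = (M : ℝ) ^ (-(2 * β)) := by
    rw [← Real.rpow_natCast, ← Real.rpow_mul hM'.le]
    congr 1
    push_cast
    ring
  have hfirst : (n : ℝ) * (4 * CovBandit.oscillation d M β L *
      (C₁ * (4 * CovBandit.oscillation d M β L) ^ α)) = n * A₁ * (M : ℝ) ^ (-(β * (α + 1))) := by
    have e : (M : ℝ) ^ (-(β * (α + 1))) = (M : ℝ) ^ (-β) * ((M : ℝ) ^ (-β)) ^ α := by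
      rw [← Real.rpow_mul hM'.le, ← Real.rpow_add hM']
      congr 1
      ring
    rw [hosc, e, hA₁, ← mul_assoc 4 c, Real.mul_rpow (by positivity) (by positivity)]
    ring
  have hsecond : ∑ k ∈ (Finset.range (n + 1)).filter
        (fun k => CovBandit.oscillation d M β L < CovBandit.confRadius (2 ^ k) T),
      4 * CovBandit.confRadius (2 ^ k) T * (K * 2 ^ k * (1 + 4 * cu)) *
        (C₁ * (4 * CovBandit.confRadius (2 ^ k) T) ^ α * ((M : ℝ) ^ d / cl)) ≤
      n * (A₂ * Cs) * (M : ℝ) ^ (-(β * (α + 1))) := by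
    have hterm : ∀ k : ℕ, 4 * CovBandit.confRadius (2 ^ k) T * (K * 2 ^ k * (1 + 4 * cu)) *
        (C₁ * (4 * CovBandit.confRadius (2 ^ k) T) ^ α * ((M : ℝ) ^ d / cl)) =
        A₂ * K * (M : ℝ) ^ d * (2 ^ k * CovBandit.confRadius (2 ^ k) T ^ (1 + α)) := by
      intro k
      have hU := CovBandit.confRadius_nonneg (2 ^ k) T
      rw [Real.mul_rpow (by positivity) hU, Real.rpow_add' hU (by positivity), Real.rpow_one, hA₂]
      ring
    calc _ = A₂ * K * (M : ℝ) ^ d * ∑ k ∈ (Finset.range (n + 1)).filter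
          (fun k => CovBandit.oscillation d M β L < CovBandit.confRadius (2 ^ k) T),
          2 ^ k * CovBandit.confRadius (2 ^ k) T ^ (1 + α) := by
          rw [Finset.mul_sum]
          exact Finset.sum_congr rfl fun k _ => hterm k
      _ ≤ A₂ * K * (M : ℝ) ^ d * ∑ k ∈ (Finset.range (n + 1)).filter (fun k : ℕ =>
          c ^ 2 * (M : ℝ) ^ (-(2 * β)) < CovBandit.confRadius (2 ^ k) T ^ 2),
          2 ^ k * CovBandit.confRadius (2 ^ k) T ^ (1 + α) := by
          refine mul_le_mul_of_nonneg_left (Finset.sum_le_sum_of_subset_of_nonneg ?_ fun k _ _ =>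
            mul_nonneg (by positivity) (Real.rpow_nonneg (CovBandit.confRadius_nonneg _ _) _))
            (by positivity)
          intro k hk
          rw [Finset.mem_filter] at hk ⊢
          refine ⟨hk.1, ?_⟩
          rw [← hsqM, ← mul_pow]
          have := hk.2
          rw [hosc] at this
          gcongr
      _ ≤ A₂ * K * (M : ℝ) ^ d *
          (Cs * Real.log K * ((M : ℝ) ^ (-(2 * β))) ^ (-((1 - α) / 2))) := by
          gcongr
          exact hsum T _ _ (by positivity) (by positivity) hlog
            (CovBandit.log_ratio_le hβ hK hM hn0 hnM) (n + 1)
      -- The exponents satisfy `d + β(1-α) = (2β+d) - β(1+α)`; the first part, together with `K log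
      -- K`, is at most `n`.
      _ = A₂ * Cs * (K * Real.log K * (M : ℝ) ^ (2 * β + d)) * (M : ℝ) ^ (-(β * (α + 1))) := by
          have e : ((M : ℝ) ^ (-(2 * β))) ^ (-((1 - α) / 2)) =
              (M : ℝ) ^ (2 * β) * (M : ℝ) ^ (-(β * (α + 1))) := by
            rw [← Real.rpow_mul hM'.le, ← Real.rpow_add hM']
            congr 1
            ring
          rw [e, Real.rpow_add hM', Real.rpow_natCast]
          ring
      _ ≤ A₂ * Cs * n * (M : ℝ) ^ (-(β * (α + 1))) := by gcongr
      _ = _ := by ring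
  calc _ ≤ n * A₁ * (M : ℝ) ^ (-(β * (α + 1))) +
        n * (A₂ * Cs) * (M : ℝ) ^ (-(β * (α + 1))) := add_le_add hfirst.le hsecond
    _ = n * (A₁ + A₂ * Cs) * (M : ℝ) ^ (-(β * (α + 1))) := by ring
    _ ≤ n * (A₁ + A₂ * Cs) * (2 ^ (β * (α + 1)) *
        (K * Real.log K / n) ^ (β * (α + 1) / (2 * β + d))) := by
        gcongr
        exact hMrate _ (by positivity)
    _ = _ := by ring
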